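/- Let $n\ge 2$ be an integer and $m=\lfloor n/2\rfloor$. There is a constant $\delta=\delta(n)>0$, depending only on $n$, with the following property. Let $\gamma\in(0,n)$, $\nu\in\left(0,\frac{n-\gamma}{2}\right)$, $R,A,\varepsilon,T>0$, and let $(f,g)\in C^1(\mathbb R^n)\times C^0(\mathbb R^n)$ be such that $f\equiv 0$, $g$ is radially symmetric (we write $g(x)=g(|x|)$), and $g(x)\ge A(1+|x|)^{-(1+\nu)}$ whenever $|x|\ge R$. Let $u=u(r,t)\in C((0,\infty)\times[0,T))$ be a radial solution, that is with $u(x,t)=u(|x|,t)$, of the integral equation $$u(x,t)=\varepsilon u^0(x,t)+\int_0^t W\!\left(\frac{F(\cdot,s)}{(1+s)^2}\,\Big|\,x,t-s\right)ds,\qquad F=(|\cdot|^{-\gamma}*u^2)\,u ,\qquad x\ne0,\ 0\le t<T,$$ where it is understood that the convolution $(|\cdot|^{-\gamma}*u^2(\cdot,t))(x)$ converges for all $x\neq 0$, $0\le t<T$, and that $F$ is continuous on $(\mathbb R^n\setminus\{0\})\times[0,T)$. Here $u^0(x,t)=\partial_tW(f|x,t)+W(f+g|x,t)$, $$W(\phi|x,t)=\frac{1}{(2m-1)!!}\left(\frac1t\frac{\partial}{\partial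 t}\right)^{m-1}\left\{t^{2m-1}M(\phi|x,t)\right\},$$ $$M(\phi|x,t)=\frac1{\omega_n}\int_{|\omega|=1}\phi(x+t\omega)\,dS_\omega\ \ (n=2m+1),\qquad M(\phi|x,t)=\frac2{\omega_{n+1}}\int_{|\xi|\le1}\frac{\phi(x+t\xi)}{\sqrt{1-|\xi|^2}}\,d\xi\ \ (n=2m),$$ and $\omega_k=2\pi^{k/2}/\Gamma(k/2)$. Put $$\Sigma=\{(r,t)\in(0,\infty)\times(0,T):\ r-t\ge\max(R,\delta t)\}.$$ Then for every $(r,t)\in\Sigma$ one has $u(r,t)>0$ and $$u(r,t)\ \ge\ \frac{\varepsilon}{8r^m}\int_{r-t}^{r+t}\lambda^m g(\lambda)\,d\lambda+\frac1{8r^m}\int_0^t\frac1{(1+s)^2}\left\{\int_{r-t+s}^{r+t-s}\lambda^m\,G_\gamma(u^2)(\lambda,s)\,u(\lambda,s)\,d\lambda\right\}ds,$$ where the integrals over $\lambda$ and over $s$ on the right converge and, for a function $U$ of $r>0$, $$G_\gamma(U)(r)=\frac{2^{3-n}\omega_{n-1}}{r^{n-2}}\int_0^\infty\rho\,U(\rho)\left\{\int_{|\rho-r|}^{\rho+r}\eta^{1-\gamma}\left[\eta^2-(\rho-r)^2\right]^{\frac{n-3}2}\left[(\rho+r)^2-\eta^2\right]^{\frac{n-3}2}d\eta\right\}d\rho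 .$$ -/

import Mathlib

open MeasureTheory Set

noncomputable section

namespace HartreeWave

/-- The area `ω_k = 2 π^{k/2} / Γ(k/2)` of the unit sphere of `ℝ^k`. -/
def sphereArea (k : ℕ) : ℝ :=
  2 * Real.pi ^ ((k : ℝ) / 2) / Real.Gamma ((k : ℝ) / 2)

/-- The mean `M(φ|x,t)`: the average of `φ` over the sphere of radius `t` about `x` if `n` is odd,
and the weighted integral over the ball obtained by the method of descent if `n` is even. -/
def waveMean (n : ℕ) (φ : EuclideanSpace ℝ (Fin n) → ℝ) (x : EuclideanSpace ℝ (Fin n)) (t : ℝ) :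
    ℝ :=
  if Even n then
    2 / sphereArea (n + 1) *
      ∫ ξ in Metric.closedBall (0 : EuclideanSpace ℝ (Fin n)) 1,
        φ (x + t • ξ) / Real.sqrt (1 - ‖ξ‖ ^ 2)
  else
    1 / sphereArea n *
      ∫ ω : Metric.sphere (0 : EuclideanSpace ℝ (Fin n)) 1,
        φ (x + t • (ω : EuclideanSpace ℝ (Fin n)))
        ∂((volume : Measure (EuclideanSpace ℝ (Fin n))).toSphere)

/-- The operator `(1/t) ∂/∂t`. -/
def invTimeDeriv (h : ℝ → ℝ) : ℝ → ℝ := fun t => 1 / t * deriv h t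

/-- The solution operator of the free wave equation in dimension `n ≥ 2`, with `m = [n/2]`:
`W(φ|x,t) = ((2m-1)!!)⁻¹ ((1/t) ∂/∂t)^{m-1} { t^{2m-1} M(φ|x,t) }`. -/
def waveOp (n : ℕ) (φ : EuclideanSpace ℝ (Fin n) → ℝ) (x : EuclideanSpace ℝ (Fin n)) (t : ℝ) : ℝ :=
  1 / (Nat.doubleFactorial (2 * (n / 2) - 1) : ℝ) *
    (invTimeDeriv^[n / 2 - 1] fun τ => τ ^ (2 * (n / 2) - 1) * waveMean n φ x τ) t

/-- The free part `u⁰(x,t) = ∂_t W(f|x,t) + W(f+g|x,t)`. -/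
def freePart (n : ℕ) (f g : EuclideanSpace ℝ (Fin n) → ℝ) (x : EuclideanSpace ℝ (Fin n)) (t : ℝ) :
    ℝ :=
  deriv (fun τ => waveOp n f x τ) t + waveOp n (fun y => f y + g y) x t

/-- The Duhamel operator `L(F)(x,t) = ∫_0^t W(F(·,s)/(1+s)² | x, t-s) ds`. -/
def duhamel (n : ℕ) (F : EuclideanSpace ℝ (Fin n) → ℝ → ℝ) (x : EuclideanSpace ℝ (Fin n)) (t : ℝ) :
    ℝ :=
  ∫ s in (0 : ℝ)..t, waveOp n (fun y => F y s / (1 + s) ^ 2) x (t - s)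

/-- The convolution `V_γ * U`, where `V_γ(x) = |x|^{-γ}`. -/
def potentialConv (n : ℕ) (γ : ℝ) (U : EuclideanSpace ℝ (Fin n) → ℝ)
    (x : EuclideanSpace ℝ (Fin n)) : ℝ :=
  ∫ y, ‖x - y‖ ^ (-γ) * U y

/-- The nonlinearity `(V_γ * u²) u` of the radial function `(x,t) ↦ u(|x|,t)`. -/
def cubicTerm (n : ℕ) (γ : ℝ) (u : ℝ → ℝ → ℝ) (x : EuclideanSpace ℝ (Fin n)) (t : ℝ) : ℝ :=
  potentialConv n γ (fun y => u ‖y‖ t ^ 2) x * u ‖x‖ t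

/-- `u = u(r,t)`, a function on `(0,∞) × [0,T)`, is a radial solution of the integral equation
`u = ε u⁰ + L((V_γ * u²) u)`: it is continuous, the convolution converges, `(V_γ * u²) u` is again
continuous (so that `L` applies to it), and the equation holds at all `(x,t)` with `x ≠ 0` and
`0 ≤ t < T`. The values of `u` at `r = 0` play no role. -/
structure IsRadialSolution (n : ℕ) (γ ε : ℝ) (f g : EuclideanSpace ℝ (Fin n) → ℝ) (T : ℝ)
    (u : ℝ → ℝ → ℝ) : Prop where
  continuousOn : ContinuousOn (fun p : ℝ × ℝ => u p.1 p.2) (Ioi 0 ×ˢ Ico 0 T)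
  integrable_conv : ∀ x : EuclideanSpace ℝ (Fin n), x ≠ 0 → ∀ t ∈ Ico 0 T,
    Integrable fun y : EuclideanSpace ℝ (Fin n) => ‖x - y‖ ^ (-γ) * u ‖y‖ t ^ 2
  continuousOn_cubicTerm :
    ContinuousOn (fun p : EuclideanSpace ℝ (Fin n) × ℝ => cubicTerm n γ u p.1 p.2)
      ({0}ᶜ ×ˢ Ico 0 T)
  equation : ∀ x : EuclideanSpace ℝ (Fin n), x ≠ 0 → ∀ t ∈ Ico 0 T,
    u ‖x‖ t = ε * freePart n f g x t + duhamel n (cubicTerm n γ u) x t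

/-- The assumptions on the data: `0 < γ < n`, `0 < ν < (n-γ)/2`, `R, A > 0`, `f ∈ C¹`, `g ∈ C⁰`,
`f ≡ 0`, `g` is radially symmetric with profile `g₀`, and `g(x) ≥ A (1+|x|)^{-(1+ν)}` for
`|x| ≥ R`. -/
structure DataAssumptions (n : ℕ) (γ ν R A : ℝ) (f g : EuclideanSpace ℝ (Fin n) → ℝ)
    (g₀ : ℝ → ℝ) : Prop where
  gamma_mem : γ ∈ Ioo 0 (n : ℝ)
  nu_mem : ν ∈ Ioo 0 (((n : ℝ) - γ) / 2)
  R_pos : 0 < R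
  A_pos : 0 < A
  contDiff_f : ContDiff ℝ 1 f
  continuous_g : Continuous g
  f_zero : ∀ x, f x = 0
  radial_g : ∀ x, g x = g₀ ‖x‖
  lower_g : ∀ x, R ≤ ‖x‖ → A / (1 + ‖x‖) ^ (1 + ν) ≤ g x

/-- The kernel `h(η,ρ,r) = {η²-(ρ-r)²}^{(n-3)/2} {(ρ+r)²-η²}^{(n-3)/2}`. -/
def sphericalKernel (n : ℕ) (η ρ r : ℝ) : ℝ :=
  (η ^ 2 - (ρ - r) ^ 2) ^ (((n : ℝ) - 3) / 2) * ((ρ + r) ^ 2 - η ^ 2) ^ (((n : ℝ) - 3) / 2)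

/-- The operator `G_γ` on radial profiles,
`G_γ(U)(r) = 2^{3-n} ω_{n-1} r^{2-n} ∫_0^∞ ρ U(ρ) { ∫_{|ρ-r|}^{ρ+r} η^{1-γ} h(η,ρ,r) dη } dρ`. -/
def radialConv (n : ℕ) (γ : ℝ) (U : ℝ → ℝ) (r : ℝ) : ℝ :=
  (2 : ℝ) ^ (3 - (n : ℤ)) * sphereArea (n - 1) / r ^ (n - 2) *
    ∫ ρ in Ioi (0 : ℝ), ρ * U ρ *
      ∫ η in |ρ - r|..(ρ + r), η ^ (1 - γ) * sphericalKernel n η ρ r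

/-- The region `Σ(T,R,δ)` of all `(r,t) ∈ (0,∞) × (0,T)` with `r - t ≥ max(R, δ t)`. -/
def exteriorRegion (T R δ : ℝ) : Set (ℝ × ℝ) :=
  {p | 0 < p.1 ∧ p.2 ∈ Ioo 0 T ∧ max R (δ * p.2) ≤ p.1 - p.2}

end HartreeWave

end

/-! For a radial function φ and 0 < t < r/2 with r = |x|, the solution operator is a one-dimensional
integral over the base of the backward cone: W(φ|x,t) = ∫_{r-t}^{r+t} (l/r)^q K(z) φ(l) dl with z =
(t² - (l-r)²)/(4rl). Here q is m (n odd) or m - 1/2 (n even), and K is continuous on z < 1 and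
depends only on n (`exists_waveOp_rep`). Indeed the distance |x+tω| has an explicit density on the
sphere, and so does its weighted analogue on the ball; hence t^{2m-1}M(φ|x,t) is a cone integral
with kernel z^{m-1}κ(z), κ smooth. Since z vanishes on the boundary of the cone, each of the m-1
operators (1/t)∂_t lowers the order of vanishing by one and leaves no boundary term
(`exists_invTimeDeriv_iterate_integral_cone`). The value K(0) need not be read off from a formula:
W(1|x,t) = t, and t → 0 forces K(0) = 1/2 (`coneKernel_zero`).

If r - t ≥ δt with δ large, then z is small, so K ≥ 1/4, and (l/r)^q ≥ (l/r)^m / 2. Thus the kernel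
is at least (l/r)^m / 8, which is the constant 1/8 of the theorem; δ comes only from the modulus of
continuity of K at 0 (`exists_coneKernel_bounds`).

Positivity is a first-zero argument in the backward cone (`pos_of_cone_equation`). For small times
the free term grows at least linearly in time while the Duhamel term is quadratically small; at a
first later zero the Duhamel term would be nonnegative and the free term positive. Once u > 0, both
kernels may be replaced by their lower bounds (`lower_bound_of_cone_equation`), and the same sphere
density turns the convolution into G_γ (`potentialConv_eq_radialConv`). -/

noncomputable section

namespace HartreeWave

open scoped ENNReal

/-! ### Polar and cylindrical coordinates, areas of spheres -/

section Polar

variable {E : Type*} [NormedAddCommGroup E] [NormedSpace ℝ E] [MeasurableSpace E] [BorelSpace E]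
  [FiniteDimensional ℝ E] [Nontrivial E] (μ : Measure E) [μ.IsAddHaarMeasure]

theorem lintegral_volumeIoiPow (k : ℕ) (f : ℝ → ℝ≥0∞) (hf : Measurable f) :
    ∫⁻ r : Ioi (0 : ℝ), f r ∂(Measure.volumeIoiPow k) =
      ∫⁻ r in Ioi (0 : ℝ), ENNReal.ofReal (r ^ k) * f r := by
  rw [Measure.volumeIoiPow, lintegral_withDensity_eq_lintegral_mul _ (by fun_prop) (by fun_prop)]
  exact lintegral_subtype_comap measurableSet_Ioi (fun r => ENNReal.ofReal (r ^ k) * f r)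

theorem lintegral_polar (f : E → ℝ≥0∞) (hf : Measurable f) :
    ∫⁻ y, f y ∂μ = ∫⁻ r in Ioi (0 : ℝ), ENNReal.ofReal (r ^ (Module.finrank ℝ E - 1)) *
      ∫⁻ ω : Metric.sphere (0 : E) 1, f (r • (ω : E)) ∂μ.toSphere := by
  have h1 : ∫⁻ y, f y ∂μ = ∫⁻ y : ({(0 : E)}ᶜ : Set E), f y ∂(μ.comap (↑)) := by
    rw [lintegral_subtype_comap (measurableSet_singleton _).compl f, restrict_compl_singleton]
  have h2 := (μ.measurePreserving_homeomorphUnitSphereProd).lintegral_comp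
    (f := fun p : Metric.sphere (0 : E) 1 × Ioi (0 : ℝ) => f ((p.2 : ℝ) • (p.1 : E)))
    (by fun_prop)
  have h3 : ∀ y : ({(0 : E)}ᶜ : Set E), ((homeomorphUnitSphereProd E y).2 : ℝ) •
      ((homeomorphUnitSphereProd E y).1 : E) = y := by
    intro y
    have : ‖(y : E)‖ ≠ 0 := norm_ne_zero_iff.2 y.2
    simp [smul_smul, this]
  simp only [h3] at h2
  rw [h1, h2, lintegral_prod_symm _ (by fun_prop)]
  refine lintegral_volumeIoiPow _
    (fun r => ∫⁻ ω : Metric.sphere (0 : E) 1, f (r • (ω : E)) ∂μ.toSphere) ?_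
  exact Measurable.lintegral_prod_left' (f := fun p : Metric.sphere (0 : E) 1 × ℝ =>
    f (p.2 • (p.1 : E))) (by fun_prop)

theorem integral_polar (f : E → ℝ) (hf : Integrable f μ) :
    ∫ y, f y ∂μ = ∫ r in Ioi (0 : ℝ), r ^ (Module.finrank ℝ E - 1) *
      ∫ ω : Metric.sphere (0 : E) 1, f (r • (ω : E)) ∂μ.toSphere := by
  have h1 : ∫ y, f y ∂μ = ∫ y : ({(0 : E)}ᶜ : Set E), f y ∂(μ.comap (↑)) := by
    rw [integral_subtype_comap (measurableSet_singleton _).compl f, restrict_compl_singleton]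
  have h3 : ∀ y : ({(0 : E)}ᶜ : Set E), ((homeomorphUnitSphereProd E y).2 : ℝ) •
      ((homeomorphUnitSphereProd E y).1 : E) = y := by
    intro y
    have : ‖(y : E)‖ ≠ 0 := norm_ne_zero_iff.2 y.2
    simp [smul_smul, this]
  have h2 := (μ.measurePreserving_homeomorphUnitSphereProd).integral_comp
    (Homeomorph.measurableEmbedding _)
    (fun p : Metric.sphere (0 : E) 1 × Ioi (0 : ℝ) => f ((p.2 : ℝ) • (p.1 : E)))
  have h4 := (μ.measurePreserving_homeomorphUnitSphereProd).integrable_comp_emb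
    (Homeomorph.measurableEmbedding _)
    (g := fun p : Metric.sphere (0 : E) 1 × Ioi (0 : ℝ) => f ((p.2 : ℝ) • (p.1 : E)))
  simp only [h3, Function.comp_def] at h2 h4
  have h5 := h4.1 (by
    have := (integrableOn_iff_comap_subtypeVal (f := f) (μ := μ)
      (measurableSet_singleton (0 : E)).compl).1 hf.integrableOn
    simpa [Function.comp_def] using this)
  rw [h1, h2, integral_prod_symm _ h5]
  simp only [Measure.volumeIoiPow, ENNReal.ofReal]
  rw [integral_withDensity_eq_integral_smul (by fun_prop),
    integral_subtype_comap measurableSet_Ioi (fun r : ℝ => Real.toNNReal (r ^ _) •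
      ∫ ω : Metric.sphere (0 : E) 1, f (r • (ω : E)) ∂μ.toSphere)]
  refine setIntegral_congr_fun measurableSet_Ioi fun r hr => ?_
  simp only [NNReal.smul_def, smul_eq_mul]
  rw [Real.coe_toNNReal _ (pow_nonneg (le_of_lt hr) _)]

end Polar

theorem sphereArea_pos {k : ℕ} (hk : 0 < k) : 0 < sphereArea k := by
  have : (0 : ℝ) < k := by exact_mod_cast hk
  unfold sphereArea
  have := Real.Gamma_pos_of_pos (s := (k : ℝ) / 2) (by positivity)
  positivity

theorem toSphere_univ {k : ℕ} (hk : 0 < k) :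
    (volume : Measure (EuclideanSpace ℝ (Fin k))).toSphere univ =
      ENNReal.ofReal (sphereArea k) := by
  have hk' : (0 : ℝ) < k := by exact_mod_cast hk
  have : Nonempty (Fin k) := ⟨⟨0, hk⟩⟩
  have hG := Real.Gamma_pos_of_pos (s := (k : ℝ) / 2) (by positivity)
  rw [Measure.toSphere_apply_univ, EuclideanSpace.volume_ball, finrank_euclideanSpace_fin,
    Fintype.card_fin, ENNReal.ofReal_one, one_pow, one_mul, ← ENNReal.ofReal_natCast,
    ← ENNReal.ofReal_mul (by positivity), sphereArea, Real.Gamma_add_one (by positivity)]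
  congr 1
  rw [Real.sqrt_eq_rpow, ← Real.rpow_natCast, ← Real.rpow_mul Real.pi_pos.le,
    one_div_mul_eq_div]
  field_simp

theorem lintegral_radial {k : ℕ} (hk : 0 < k) (f : ℝ → ℝ≥0∞) (hf : Measurable f) :
    ∫⁻ y : EuclideanSpace ℝ (Fin k), f ‖y‖ = ENNReal.ofReal (sphereArea k) *
      ∫⁻ r in Ioi (0 : ℝ), ENNReal.ofReal (r ^ (k - 1)) * f r := by
  have : Nonempty (Fin k) := ⟨⟨0, hk⟩⟩
  rw [lintegral_polar volume _ (by fun_prop), ← lintegral_const_mul _ (by fun_prop)]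
  refine setLIntegral_congr_fun measurableSet_Ioi fun r (hr : 0 < r) => ?_
  simp only [norm_smul, Real.norm_of_nonneg hr.le, norm_eq_of_mem_sphere, mul_one,
    lintegral_const, toSphere_univ hk, finrank_euclideanSpace_fin]
  ring

/-- Cylindrical coordinates about the axis spanned by the unit vector `e`. -/
theorem lintegral_cylinder {k : ℕ} (hk : 0 < k) (e : EuclideanSpace ℝ (Fin (k + 1)))
    (he : ‖e‖ = 1) (f : ℝ × ℝ → ℝ≥0∞) (hf : Measurable f) :
    ∫⁻ y : EuclideanSpace ℝ (Fin (k + 1)), f (inner ℝ e y, ‖y‖) =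
      ENNReal.ofReal (sphereArea k) * ∫⁻ s : ℝ, ∫⁻ q in Ioi (0 : ℝ),
        ENNReal.ofReal (q ^ (k - 1)) * f (s, Real.sqrt (s ^ 2 + q ^ 2)) := by
  -- Completing `e` to an orthonormal basis with index 0 makes the inner product with `e` the zeroth
  -- coordinate; the remaining k coordinates enter only through their norm.
  have hv : Orthonormal ℝ (({0} : Set (Fin (k + 1))).domRestrict
      (fun _ : Fin (k + 1) => e)) := by
    rw [orthonormal_iff_ite]
    rintro ⟨i, hi⟩ ⟨j, hj⟩
    simp only [mem_singleton_iff] at hi hj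
    subst hi hj
    simp [Set.domRestrict, he]
  obtain ⟨b, hb⟩ := hv.exists_orthonormalBasis_extension_of_card_eq (by simp)
  have hb0 : b 0 = e := hb 0 rfl
  have h1 := (b.measurePreserving_repr_symm).lintegral_comp
    (f := fun y => f (inner ℝ e y, ‖y‖)) (by fun_prop)
  have h2 := (PiLp.volume_preserving_toLp (Fin (k + 1))).lintegral_comp
    (f := fun y => f (inner ℝ e (b.repr.symm y), ‖b.repr.symm y‖)) (by fun_prop)
  have h3 := (volume_preserving_piFinSuccAbove (fun _ : Fin (k + 1) => ℝ) 0).symm.lintegral_comp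
    (f := fun y => f (inner ℝ e (b.repr.symm (WithLp.toLp 2 y)),
      ‖b.repr.symm (WithLp.toLp 2 y)‖)) (by fun_prop)
  have h4 : ∀ p : ℝ × (Fin k → ℝ), f (inner ℝ e (b.repr.symm (WithLp.toLp 2
      ((MeasurableEquiv.piFinSuccAbove (fun _ : Fin (k + 1) => ℝ) 0).symm p))),
      ‖b.repr.symm (WithLp.toLp 2
      ((MeasurableEquiv.piFinSuccAbove (fun _ : Fin (k + 1) => ℝ) 0).symm p))‖) =
      f (p.1, Real.sqrt (p.1 ^ 2 + ‖(WithLp.toLp 2 p.2 : EuclideanSpace ℝ (Fin k))‖ ^ 2)) := by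
    rintro ⟨s, z⟩
    congr 2
    · rw [← hb0, ← b.repr_apply_apply]
      simp [MeasurableEquiv.piFinSuccAbove]
    · rw [LinearIsometryEquiv.norm_map, EuclideanSpace.norm_eq, EuclideanSpace.norm_eq,
        Real.sq_sqrt (by positivity)]
      simp [MeasurableEquiv.piFinSuccAbove, Fin.sum_univ_succ]
  rw [← h1, ← h2, ← h3]
  simp only [h4]
  rw [Measure.volume_eq_prod, lintegral_prod _ (by fun_prop),
    ← lintegral_const_mul _ (Measurable.lintegral_prod_right' (f := fun p : ℝ × ℝ =>
      ENNReal.ofReal (p.2 ^ (k - 1)) * f (p.1, √(p.1 ^ 2 + p.2 ^ 2))) (by fun_prop))]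
  refine lintegral_congr fun s => ?_
  have h5 := (PiLp.volume_preserving_toLp (Fin k)).lintegral_comp
    (f := fun z => f (s, Real.sqrt (s ^ 2 + ‖z‖ ^ 2))) (by fun_prop)
  rw [h5]
  exact lintegral_radial hk (fun q => f (s, Real.sqrt (s ^ 2 + q ^ 2))) (by fun_prop)

end HartreeWave

/-! ### The Funk–Hecke formula -/

namespace HartreeWave

open scoped ENNReal

theorem lintegral_upperHalfPlane_polar (G : ℝ × ℝ → ℝ≥0∞) (hG : Measurable G) :
    ∫⁻ s : ℝ, ∫⁻ q in Ioi (0 : ℝ), G (s, q) = ∫⁻ ρ in Ioi (0 : ℝ), ∫⁻ θ in Ioo 0 Real.pi,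
      ENNReal.ofReal ρ * G (ρ * Real.cos θ, ρ * Real.sin θ) := by
  have hS : MeasurableSet {p : ℝ × ℝ | 0 < p.2} := measurableSet_lt measurable_const measurable_snd
  have h1 : ∫⁻ s : ℝ, ∫⁻ q in Ioi (0 : ℝ), G (s, q) =
      ∫⁻ p : ℝ × ℝ, indicator {p : ℝ × ℝ | 0 < p.2} G p := by
    rw [Measure.volume_eq_prod, lintegral_prod _ (hG.indicator hS).aemeasurable]
    refine lintegral_congr fun s => ?_
    rw [← lintegral_indicator measurableSet_Ioi]
    rfl
  rw [h1, ← lintegral_comp_polarCoord_symm, polarCoord_target, Measure.volume_eq_prod,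
    ← Measure.prod_restrict]
  have hm : Measurable fun p : ℝ × ℝ => ENNReal.ofReal p.1 •
      indicator {p : ℝ × ℝ | 0 < p.2} G (polarCoord.symm p) := by
    refine (ENNReal.measurable_ofReal.comp measurable_fst).smul ?_
    exact (hG.indicator hS).comp continuous_polarCoord_symm.measurable
  rw [lintegral_prod _ hm.aemeasurable]
  refine setLIntegral_congr_fun measurableSet_Ioi fun ρ (hρ : 0 < ρ) => ?_
  simp only []
  rw [← lintegral_indicator measurableSet_Ioo, ← lintegral_indicator measurableSet_Ioo]
  refine lintegral_congr fun θ => ?_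
  simp only [indicator, polarCoord_symm_apply, smul_eq_mul, mem_Ioo, mem_ofPred_eq,
    mul_pos_iff_of_pos_left hρ]
  by_cases h : 0 < θ ∧ θ < Real.pi
  · have := Real.sin_pos_of_pos_of_lt_pi h.1 h.2
    have h' : -Real.pi < θ ∧ θ < Real.pi := ⟨by linarith [Real.pi_pos], h.2⟩
    simp [h, h', this]
  · by_cases h' : -Real.pi < θ ∧ θ < Real.pi
    · have h0 : θ ≤ 0 := by
        by_contra h0
        exact h ⟨not_le.1 h0, h'.2⟩
      have := Real.sin_nonpos_of_nonpos_of_neg_pi_le h0 h'.1.le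
      simp [h', this.not_gt, h0.not_gt]
    · simp [h, h']

/-- The Funk–Hecke formula. -/
theorem lintegral_sphere_inner {k : ℕ} (hk : 0 < k) (e : EuclideanSpace ℝ (Fin (k + 1)))
    (he : ‖e‖ = 1) (F : ℝ → ℝ≥0∞) (hF : Measurable F) :
    ∫⁻ ω : Metric.sphere (0 : EuclideanSpace ℝ (Fin (k + 1))) 1, F (inner ℝ e ω)
        ∂(volume : Measure (EuclideanSpace ℝ (Fin (k + 1)))).toSphere =
      ENNReal.ofReal (sphereArea k) *
        ∫⁻ θ in Ioo 0 Real.pi, ENNReal.ofReal (Real.sin θ ^ (k - 1)) * F (Real.cos θ) := by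
  -- The cutoff to the unit ball makes the radial factor `c` finite and nonzero. The function
  -- F(⟨e,y⟩/|y|)·χ(|y|) is integrated in polar and in cylindrical coordinates; both give `c` times
  -- an angular integral, and `c` is cancelled.
  set χ : ℝ → ℝ≥0∞ := indicator (Iio 1) 1 with hχ
  have hχm : Measurable χ := measurable_one.indicator measurableSet_Iio
  set c := ∫⁻ r in Ioi (0 : ℝ), ENNReal.ofReal (r ^ k) * χ r with hc
  have hcball : volume (Metric.ball (0 : EuclideanSpace ℝ (Fin (k + 1))) 1) =
      ENNReal.ofReal (sphereArea (k + 1)) * c := by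
    have := lintegral_radial (k := k + 1) k.succ_pos χ hχm
    rw [add_tsub_cancel_right] at this
    rw [hc, ← this, ← lintegral_indicator_one measurableSet_ball]
    refine lintegral_congr fun y => ?_
    simp [hχ, indicator]
  have hc0 : c ≠ 0 := by
    intro h
    rw [h, mul_zero] at hcball
    exact (Metric.measure_ball_pos volume _ one_pos).ne' hcball
  have hctop : c ≠ ⊤ := by
    intro h
    rw [h, ENNReal.mul_top (by simpa using sphereArea_pos k.succ_pos)] at hcball
    exact measure_ball_lt_top.ne hcball
  have hcyl := lintegral_cylinder hk e he (fun p => F (p.1 / p.2) * χ p.2) (by fun_prop)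
  have hleft : ∫⁻ y : EuclideanSpace ℝ (Fin (k + 1)), F (inner ℝ e y / ‖y‖) * χ ‖y‖ =
      c * ∫⁻ ω : Metric.sphere (0 : EuclideanSpace ℝ (Fin (k + 1))) 1, F (inner ℝ e ω)
        ∂(volume : Measure (EuclideanSpace ℝ (Fin (k + 1)))).toSphere := by
    rw [lintegral_polar volume _ (by fun_prop), hc, ← lintegral_mul_const _ (by fun_prop)]
    refine setLIntegral_congr_fun measurableSet_Ioi fun r (hr : 0 < r) => ?_
    simp only [norm_smul, Real.norm_of_nonneg hr.le, norm_eq_of_mem_sphere, mul_one,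
      finrank_euclideanSpace_fin, add_tsub_cancel_right, inner_smul_right, mul_div_cancel_left₀ _ hr.ne']
    rw [lintegral_mul_const _ (by fun_prop)]
    ring
  have hright : ∫⁻ s : ℝ, ∫⁻ q in Ioi (0 : ℝ), ENNReal.ofReal (q ^ (k - 1)) *
      (F (s / √(s ^ 2 + q ^ 2)) * χ (√(s ^ 2 + q ^ 2))) =
      c * ∫⁻ θ in Ioo 0 Real.pi, ENNReal.ofReal (Real.sin θ ^ (k - 1)) * F (Real.cos θ) := by
    rw [lintegral_upperHalfPlane_polar (fun p => ENNReal.ofReal (p.2 ^ (k - 1)) *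
      (F (p.1 / √(p.1 ^ 2 + p.2 ^ 2)) * χ (√(p.1 ^ 2 + p.2 ^ 2)))) (by fun_prop), hc,
      ← lintegral_mul_const _ (by fun_prop)]
    refine setLIntegral_congr_fun measurableSet_Ioi fun r (hr : 0 < r) => ?_
    simp only []
    rw [← lintegral_const_mul _ (by fun_prop)]
    refine setLIntegral_congr_fun measurableSet_Ioo fun θ hθ => ?_
    have hs : √((r * Real.cos θ) ^ 2 + (r * Real.sin θ) ^ 2) = r := by
      rw [show (r * Real.cos θ) ^ 2 + (r * Real.sin θ) ^ 2 = r ^ 2 by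
        linear_combination r ^ 2 * Real.sin_sq_add_cos_sq θ, Real.sqrt_sq hr.le]
    have hp : r ^ k = r * r ^ (k - 1) := by
      rw [← pow_succ', Nat.sub_add_cancel hk]
    simp only [hs, mul_div_cancel_left₀ _ hr.ne']
    rw [mul_pow, hp, ENNReal.ofReal_mul (by positivity), ENNReal.ofReal_mul hr.le]
    ring
  rw [hleft] at hcyl
  simp only [] at hcyl
  rw [hright, mul_left_comm] at hcyl
  exact (ENNReal.mul_right_inj hc0 hctop).1 hcyl

/-- The integral of `sin^{k-1}` expressed by areas of spheres. -/
theorem sphereArea_succ {k : ℕ} (hk : 0 < k) :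
    ENNReal.ofReal (sphereArea (k + 1)) = ENNReal.ofReal (sphereArea k) *
      ∫⁻ θ in Ioo 0 Real.pi, ENNReal.ofReal (Real.sin θ ^ (k - 1)) := by
  have h := lintegral_sphere_inner hk (EuclideanSpace.single 0 1) (by simp) 1 measurable_one
  simpa [-Measure.toSphere_apply_univ, toSphere_univ] using h

end HartreeWave

/-! ### The distribution of |x + ρω| on the sphere -/

namespace HartreeWave

open scoped ENNReal

section Triangle

variable {r ρ : ℝ}

/-- The third side of the triangle with sides `r`, `ρ` enclosing the angle `θ`. -/
def thirdSide (r ρ θ : ℝ) : ℝ := Real.sqrt (r ^ 2 + ρ ^ 2 - 2 * r * ρ * Real.cos θ)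

theorem thirdSide_radicand_pos (hr : 0 < r) (hρ : 0 < ρ) {θ : ℝ} (hθ : θ ∈ Ioo 0 Real.pi) :
    (ρ - r) ^ 2 < r ^ 2 + ρ ^ 2 - 2 * r * ρ * Real.cos θ := by
  have h1 : Real.cos θ < 1 := by
    have := Real.cos_lt_cos_of_nonneg_of_le_pi le_rfl hθ.2.le hθ.1
    rwa [Real.cos_zero] at this
  nlinarith [mul_pos hr hρ]

theorem thirdSide_pos (hr : 0 < r) (hρ : 0 < ρ) {θ : ℝ} (hθ : θ ∈ Ioo 0 Real.pi) :
    0 < thirdSide r ρ θ :=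
  Real.sqrt_pos.2 ((sq_nonneg _).trans_lt (thirdSide_radicand_pos hr hρ hθ))

theorem thirdSide_sq (hr : 0 < r) (hρ : 0 < ρ) {θ : ℝ} (hθ : θ ∈ Ioo 0 Real.pi) :
    thirdSide r ρ θ ^ 2 = r ^ 2 + ρ ^ 2 - 2 * r * ρ * Real.cos θ :=
  Real.sq_sqrt ((sq_nonneg _).trans_lt (thirdSide_radicand_pos hr hρ hθ)).le

theorem thirdSide_image (hr : 0 < r) (hρ : 0 < ρ) :
    thirdSide r ρ '' Ioo 0 Real.pi = Ioo |ρ - r| (ρ + r) := by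
  have hrρ := mul_pos hr hρ
  ext l
  constructor
  · rintro ⟨θ, hθ, rfl⟩
    have h2 : -1 < Real.cos θ := by
      have := Real.cos_lt_cos_of_nonneg_of_le_pi hθ.1.le le_rfl hθ.2
      rwa [Real.cos_pi] at this
    constructor
    · rw [← Real.sqrt_sq_eq_abs]
      exact Real.sqrt_lt_sqrt (sq_nonneg _) (thirdSide_radicand_pos hr hρ hθ)
    · rw [thirdSide, Real.sqrt_lt' (by positivity)]
      nlinarith
  · rintro ⟨h1, h2⟩
    have hl : 0 < l := (abs_nonneg _).trans_lt h1
    have h3 : (ρ - r) ^ 2 < l ^ 2 := by rw [← sq_abs]; exact pow_lt_pow_left₀ h1 (abs_nonneg _) two_ne_zero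
    have h4 : l ^ 2 < (ρ + r) ^ 2 := pow_lt_pow_left₀ h2 hl.le two_ne_zero
    set c := (r ^ 2 + ρ ^ 2 - l ^ 2) / (2 * r * ρ) with hc
    have hc1 : c < 1 := by rw [hc, div_lt_one (by positivity)]; nlinarith
    have hc2 : -1 < c := by rw [hc, lt_div_iff₀ (by positivity)]; nlinarith
    refine ⟨Real.arccos c, ⟨Real.arccos_pos.2 hc1, ?_⟩, ?_⟩
    · refine lt_of_le_of_ne (Real.arccos_le_pi _) fun h => ?_
      rw [Real.arccos_eq_pi] at h
      linarith
    · rw [thirdSide, Real.cos_arccos hc2.le hc1.le, hc]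
      rw [show r ^ 2 + ρ ^ 2 - 2 * r * ρ * ((r ^ 2 + ρ ^ 2 - l ^ 2) / (2 * r * ρ)) = l ^ 2 by
        field_simp; ring, Real.sqrt_sq hl.le]

theorem thirdSide_injOn (hr : 0 < r) (hρ : 0 < ρ) : InjOn (thirdSide r ρ) (Ioo 0 Real.pi) := by
  intro a ha b hb h
  have h1 := thirdSide_sq hr hρ ha
  rw [h, thirdSide_sq hr hρ hb] at h1
  refine Real.injOn_cos ⟨ha.1.le, ha.2.le⟩ ⟨hb.1.le, hb.2.le⟩ ?_
  have : 2 * r * ρ ≠ 0 := by positivity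
  apply mul_left_cancel₀ this
  linarith

theorem hasDerivAt_thirdSide (hr : 0 < r) (hρ : 0 < ρ) {θ : ℝ} (hθ : θ ∈ Ioo 0 Real.pi) :
    HasDerivAt (thirdSide r ρ) (r * ρ * Real.sin θ / thirdSide r ρ θ) θ := by
  have h := (((Real.hasDerivAt_cos θ).const_mul (2 * r * ρ)).const_sub (r ^ 2 + ρ ^ 2)).sqrt
    ((sq_nonneg _).trans_lt (thirdSide_radicand_pos hr hρ hθ)).ne'
  have h1 := thirdSide_pos hr hρ hθ
  refine h.congr_deriv ?_
  change _ / (2 * thirdSide r ρ θ) = _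
  field_simp

theorem lintegral_thirdSide (hr : 0 < r) (hρ : 0 < ρ) (G : ℝ → ℝ≥0∞) :
    ∫⁻ l in Ioo |ρ - r| (ρ + r), G l = ∫⁻ θ in Ioo 0 Real.pi,
      ENNReal.ofReal (r * ρ * Real.sin θ / thirdSide r ρ θ) * G (thirdSide r ρ θ) := by
  rw [← thirdSide_image hr hρ, lintegral_image_eq_lintegral_abs_deriv_mul measurableSet_Ioo
    (fun θ hθ => (hasDerivAt_thirdSide hr hρ hθ).hasDerivWithinAt) (thirdSide_injOn hr hρ)]
  refine setLIntegral_congr_fun measurableSet_Ioo fun θ hθ => ?_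
  have h1 := thirdSide_pos hr hρ hθ
  have h2 := Real.sin_pos_of_pos_of_lt_pi hθ.1 hθ.2
  rw [abs_of_pos (by positivity)]

/-- By the law of cosines the two brackets are 2rρ(1 - cos θ) and 2rρ(1 + cos θ), with product (2rρ
sin θ)². The factor sin θ from dl supplies the missing power for the weight sin^{n-2} θ of
Funk–Hecke. -/
theorem sphericalKernel_thirdSide (n : ℕ) (hr : 0 < r) (hρ : 0 < ρ) {θ : ℝ}
    (hθ : θ ∈ Ioo 0 Real.pi) :
    sphericalKernel n (thirdSide r ρ θ) ρ r =
      (2 * r * ρ) ^ ((n : ℝ) - 3) * Real.sin θ ^ ((n : ℝ) - 3) := by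
  have h2 := Real.sin_pos_of_pos_of_lt_pi hθ.1 hθ.2
  have h3 := Real.sin_sq_add_cos_sq θ
  have h4 : 0 < 1 - Real.cos θ := by nlinarith [Real.neg_one_le_cos θ, Real.cos_le_one θ]
  have h5 : 0 < 1 + Real.cos θ := by nlinarith [Real.neg_one_le_cos θ, Real.cos_le_one θ]
  have hrρ := mul_pos hr hρ
  rw [sphericalKernel, thirdSide_sq hr hρ hθ, ← Real.mul_rpow (by nlinarith) (by nlinarith),
    ← Real.mul_rpow (by positivity) h2.le,
    show (r ^ 2 + ρ ^ 2 - 2 * r * ρ * Real.cos θ - (ρ - r) ^ 2) *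
      ((ρ + r) ^ 2 - (r ^ 2 + ρ ^ 2 - 2 * r * ρ * Real.cos θ)) =
      (2 * r * ρ * Real.sin θ) ^ (2 : ℝ) by
        rw [Real.rpow_two]; linear_combination (-(2 * r * ρ) ^ 2) * h3,
    ← Real.rpow_mul (by positivity)]
  congr 1
  ring

end Triangle

/-- The density of the distribution of `|x + ρ ω|`, `|x| = r`, over the unit sphere. -/
def sphereDensity (n : ℕ) (r ρ l : ℝ) : ℝ :=
  sphereArea (n - 1) * (2 * r * ρ) ^ (3 - (n : ℝ)) / (r * ρ) * (l * sphericalKernel n l ρ r)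

theorem measurable_sphereDensity (n : ℕ) :
    Measurable fun p : ℝ × ℝ × ℝ => sphereDensity n p.1 p.2.1 p.2.2 := by
  unfold sphereDensity sphericalKernel
  fun_prop

theorem sphericalKernel_nonneg (n : ℕ) {r ρ l : ℝ} (hl : l ∈ Icc |ρ - r| (ρ + r)) :
    0 ≤ sphericalKernel n l ρ r := by
  have h0 : 0 ≤ l := (abs_nonneg _).trans hl.1
  have h1 : (ρ - r) ^ 2 ≤ l ^ 2 := by rw [← sq_abs]; exact pow_le_pow_left₀ (abs_nonneg _) hl.1 2
  have h2 : l ^ 2 ≤ (ρ + r) ^ 2 := pow_le_pow_left₀ h0 hl.2 2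
  exact mul_nonneg (Real.rpow_nonneg (by linarith) _) (Real.rpow_nonneg (by linarith) _)

theorem sphereDensity_nonneg {n : ℕ} (hn : 2 ≤ n) {r ρ l : ℝ} (hr : 0 < r) (hρ : 0 < ρ)
    (hl : l ∈ Icc |ρ - r| (ρ + r)) : 0 ≤ sphereDensity n r ρ l := by
  have h0 : 0 ≤ l := (abs_nonneg _).trans hl.1
  have h1 := sphericalKernel_nonneg n hl
  have h2 := sphereArea_pos (k := n - 1) (by omega)
  unfold sphereDensity
  positivity

theorem lintegral_sphere_norm_add {n : ℕ} (hn : 2 ≤ n) {x : EuclideanSpace ℝ (Fin n)} (hx : x ≠ 0)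
    {ρ : ℝ} (hρ : 0 < ρ) (f : ℝ → ℝ≥0∞) (hf : Measurable f) :
    ∫⁻ ω : Metric.sphere (0 : EuclideanSpace ℝ (Fin n)) 1, f ‖x + ρ • (ω : EuclideanSpace ℝ (Fin n))‖
        ∂(volume : Measure (EuclideanSpace ℝ (Fin n))).toSphere =
      ∫⁻ l in Ioo |ρ - ‖x‖| (ρ + ‖x‖), ENNReal.ofReal (sphereDensity n ‖x‖ ρ l) * f l := by
  obtain ⟨k, rfl⟩ : ∃ k, n = k + 1 := ⟨n - 1, by omega⟩
  have hk : 0 < k := by omega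
  have hr : 0 < ‖x‖ := norm_pos_iff.2 hx
  have hω := sphereArea_pos hk
  -- The sign is chosen so that |x + ρω| is exactly `thirdSide` at the angle between `e` and ω.
  set e : EuclideanSpace ℝ (Fin (k + 1)) := -(‖x‖⁻¹ • x) with he
  have he1 : ‖e‖ = 1 := by
    rw [he, norm_neg, norm_smul, norm_inv, norm_norm, inv_mul_cancel₀ hr.ne']
  have hnorm : ∀ ω : Metric.sphere (0 : EuclideanSpace ℝ (Fin (k + 1))) 1,
      ‖x + ρ • (ω : EuclideanSpace ℝ (Fin (k + 1)))‖ =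
        Real.sqrt (‖x‖ ^ 2 + ρ ^ 2 - 2 * ‖x‖ * ρ * inner ℝ e (ω : EuclideanSpace ℝ (Fin (k + 1)))) := by
    intro ω
    rw [← Real.sqrt_sq (norm_nonneg (x + _)), norm_add_sq_real, inner_smul_right, norm_smul,
      norm_eq_of_mem_sphere, he, inner_neg_left, inner_smul_left, mul_one, Real.norm_eq_abs, sq_abs]
    simp only [conj_trivial]
    congr 1
    field_simp
    ring
  simp only [hnorm]
  rw [lintegral_sphere_inner hk e he1
    (fun s => f (Real.sqrt (‖x‖ ^ 2 + ρ ^ 2 - 2 * ‖x‖ * ρ * s))) (by fun_prop),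
    lintegral_thirdSide hr hρ, ← lintegral_const_mul _ (by fun_prop)]
  refine setLIntegral_congr_fun measurableSet_Ioo fun θ hθ => ?_
  have h1 := thirdSide_pos hr hρ hθ
  have h2 := Real.sin_pos_of_pos_of_lt_pi hθ.1 hθ.2
  rw [← mul_assoc, ← mul_assoc, ← ENNReal.ofReal_mul hω.le, ← ENNReal.ofReal_mul (by positivity)]
  congr 2
  rw [sphereDensity, sphericalKernel_thirdSide _ hr hρ hθ, add_tsub_cancel_right]
  have h3 : (2 * ‖x‖ * ρ) ^ (3 - ((k + 1 : ℕ) : ℝ)) * (2 * ‖x‖ * ρ) ^ (((k + 1 : ℕ) : ℝ) - 3) = 1 := by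
    rw [← Real.rpow_add (by positivity)]; simp
  have h4 : Real.sin θ * Real.sin θ ^ (((k + 1 : ℕ) : ℝ) - 3) = Real.sin θ ^ (k - 1) := by
    nth_rewrite 1 [← Real.rpow_one (Real.sin θ)]
    rw [← Real.rpow_add h2, ← Real.rpow_natCast]
    congr 1
    push_cast [Nat.cast_sub hk]
    ring
  rw [← h4]
  generalize (2 * ‖x‖ * ρ) ^ (3 - ((k + 1 : ℕ) : ℝ)) = P at h3 ⊢
  generalize (2 * ‖x‖ * ρ) ^ (((k + 1 : ℕ) : ℝ) - 3) = P' at h3 ⊢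
  field_simp
  linear_combination -h3

end HartreeWave

/-! ### From densities to integrals; the convolution as G_γ -/

namespace HartreeWave

open scoped ENNReal

/-- If a weighted distribution has a density then integrals can be computed from the density. -/
theorem integral_comp_of_lintegral_density {α : Type*} [MeasurableSpace α] {μ : Measure α}
    {X : α → ℝ} (hX : Measurable X) {s : Set ℝ} (hs : MeasurableSet s) {D : ℝ → ℝ}
    (hD : Measurable D) (hD0 : ∀ l ∈ s, 0 ≤ D l)
    (h : ∀ f : ℝ → ℝ≥0∞, Measurable f →
      ∫⁻ a, f (X a) ∂μ = ∫⁻ l in s, ENNReal.ofReal (D l) * f l)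
    {f : ℝ → ℝ} (hf : Measurable f) : ∫ a, f (X a) ∂μ = ∫ l in s, D l * f l := by
  -- Identifying the pushforward measure itself gives the formula for every measurable real `f`,
  -- with no integrability to check.
  have h1 : μ.map X = (volume.restrict s).withDensity (fun l => ENNReal.ofReal (D l)) := by
    refine Measure.ext_of_lintegral _ fun f hf => ?_
    rw [lintegral_map hf hX, h f hf,
      lintegral_withDensity_eq_lintegral_mul _ hD.ennreal_ofReal hf]
    rfl
  rw [← integral_map hX.aemeasurable hf.aestronglyMeasurable, h1]
  simp only [ENNReal.ofReal]
  rw [integral_withDensity_eq_integral_smul hD.real_toNNReal]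
  refine setIntegral_congr_fun hs fun l hl => ?_
  simp only [NNReal.smul_def, smul_eq_mul, Real.coe_toNNReal _ (hD0 l hl)]

theorem integral_sphere_norm_add {n : ℕ} (hn : 2 ≤ n) {x : EuclideanSpace ℝ (Fin n)} (hx : x ≠ 0)
    {ρ : ℝ} (hρ : 0 < ρ) (f : ℝ → ℝ) (hf : Measurable f) :
    ∫ ω : Metric.sphere (0 : EuclideanSpace ℝ (Fin n)) 1, f ‖x + ρ • (ω : EuclideanSpace ℝ (Fin n))‖
        ∂(volume : Measure (EuclideanSpace ℝ (Fin n))).toSphere =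
      ∫ l in Ioo |ρ - ‖x‖| (ρ + ‖x‖), sphereDensity n ‖x‖ ρ l * f l := by
  have hr : 0 < ‖x‖ := norm_pos_iff.2 hx
  refine integral_comp_of_lintegral_density (by fun_prop) measurableSet_Ioo
    ((measurable_sphereDensity n).comp (by fun_prop : Measurable fun l : ℝ => (‖x‖, ρ, l)))
    (fun l hl => sphereDensity_nonneg hn hr hρ (Ioo_subset_Icc_self hl))
    (fun f hf => lintegral_sphere_norm_add hn hx hρ f hf) hf

/-- The convolution of a radial function with `|x|^{-γ}` is given by the operator `G_γ`. -/
theorem potentialConv_eq_radialConv {n : ℕ} (hn : 2 ≤ n) (γ : ℝ) (U : ℝ → ℝ)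
    {x : EuclideanSpace ℝ (Fin n)} (hx : x ≠ 0)
    (hU : Integrable fun y : EuclideanSpace ℝ (Fin n) => ‖x - y‖ ^ (-γ) * U ‖y‖) :
    potentialConv n γ (fun y => U ‖y‖) x = radialConv n γ U ‖x‖ := by
  have hr : 0 < ‖x‖ := norm_pos_iff.2 hx
  have : Nonempty (Fin n) := ⟨⟨0, by omega⟩⟩
  rw [potentialConv, integral_polar volume _ hU, radialConv, ← integral_const_mul]
  refine setIntegral_congr_fun measurableSet_Ioi fun ρ (hρ : 0 < ρ) => ?_
  -- The convolution contains x - y, the density is for sums: the latter is applied to -x, which has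
  -- the same norm.
  have h1 : ∀ ω : Metric.sphere (0 : EuclideanSpace ℝ (Fin n)) 1,
      ‖x - ρ • (ω : EuclideanSpace ℝ (Fin n))‖ = ‖(-x) + ρ • (ω : EuclideanSpace ℝ (Fin n))‖ := by
    intro ω
    rw [← norm_neg]
    congr 1
    abel
  have h2 : |ρ - ‖x‖| ≤ ρ + ‖x‖ := abs_le.2 ⟨by linarith, by linarith⟩
  simp only [norm_smul, Real.norm_of_nonneg hρ.le, norm_eq_of_mem_sphere, mul_one,
    finrank_euclideanSpace_fin, h1]
  rw [integral_mul_const, integral_sphere_norm_add hn (neg_ne_zero.2 hx) hρ (fun s => s ^ (-γ))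
    (by fun_prop), norm_neg, intervalIntegral.integral_of_le h2, integral_Ioc_eq_integral_Ioo]
  have h3 : ∫ l in Ioo |ρ - ‖x‖| (ρ + ‖x‖), sphereDensity n ‖x‖ ρ l * l ^ (-γ) =
      sphereArea (n - 1) * (2 * ‖x‖ * ρ) ^ (3 - (n : ℝ)) / (‖x‖ * ρ) *
        ∫ l in Ioo |ρ - ‖x‖| (ρ + ‖x‖), l ^ (1 - γ) * sphericalKernel n l ρ ‖x‖ := by
    rw [← integral_const_mul]
    refine setIntegral_congr_fun measurableSet_Ioo fun l hl => ?_
    have hl0 : 0 < l := (abs_nonneg _).trans_lt hl.1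
    simp only [sphereDensity]
    rw [sub_eq_add_neg 1 γ, Real.rpow_add hl0, Real.rpow_one]
    ring
  rw [h3]
  have h4 : (2 * ‖x‖ * ρ) ^ (3 - (n : ℝ)) = 2 ^ (3 - (n : ℤ)) * (‖x‖ * ‖x‖ ^ (2 - (n : ℤ))) *
      (ρ * ρ ^ (2 - (n : ℤ))) := by
    rw [show (3 : ℝ) - n = ((3 - n : ℤ) : ℝ) by push_cast; ring, Real.rpow_intCast, mul_zpow,
      mul_zpow, ← zpow_one_add₀ hr.ne', ← zpow_one_add₀ hρ.ne']
    ring_nf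
  obtain ⟨k, rfl⟩ : ∃ k, n = k + 2 := ⟨n - 2, by omega⟩
  rw [h4, show (2 : ℤ) - ((k + 2 : ℕ) : ℤ) = -(k : ℤ) by push_cast; ring, zpow_neg, zpow_neg,
    zpow_natCast, zpow_natCast, add_tsub_cancel_right, show k + 2 - 1 = k + 1 by omega, pow_succ]
  field_simp

end HartreeWave

/-! ### Cone integrals and the operator (1/t) ∂/∂t -/

namespace HartreeWave

open scoped ContDiff Topology

/-- The relative height of the point `(l, 0)` in the backward light cone of `(r, t)`. -/
def coneRatio (r t l : ℝ) : ℝ := (t ^ 2 - (l - r) ^ 2) / (4 * r * l)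

theorem coneRatio_le {r t l : ℝ} (hr : 0 < r) (ht : t ∈ Icc 0 (r / 2)) (hl : r / 2 ≤ l) :
    coneRatio r t l ≤ 1 / 8 := by
  have hl0 : 0 < l := by linarith
  obtain ⟨h0, h1⟩ := ht
  rw [coneRatio, div_le_iff₀ (by positivity)]
  nlinarith [sq_nonneg (l - r)]

theorem coneRatio_lt_one {r t l : ℝ} (hr : 0 < r) (ht : t ∈ Icc 0 (r / 2)) (hl : r / 2 ≤ l) :
    coneRatio r t l < 1 := (coneRatio_le hr ht hl).trans_lt (by norm_num)

theorem coneRatio_nonneg {r t l : ℝ} (hr : 0 < r) (hl : 0 < l) (h : |l - r| ≤ t) :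
    0 ≤ coneRatio r t l := by
  have : (l - r) ^ 2 ≤ t ^ 2 := by
    rw [← sq_abs]; exact pow_le_pow_left₀ (abs_nonneg _) h 2
  exact div_nonneg (by linarith) (by positivity)

theorem coneRatio_pos {r t l : ℝ} (hr : 0 < r) (hl : 0 < l) (h : |l - r| < t) :
    0 < coneRatio r t l := by
  have : (l - r) ^ 2 < t ^ 2 := by
    rw [← sq_abs]; exact pow_lt_pow_left₀ h (abs_nonneg _) two_ne_zero
  exact div_pos (by linarith) (by positivity)

theorem coneRatio_nonpos {r t l : ℝ} (hr : 0 < r) (hl : 0 < l) (ht : 0 ≤ t) (h : t ≤ |l - r|) :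
    coneRatio r t l ≤ 0 := by
  have : t ^ 2 ≤ (l - r) ^ 2 := by
    rw [← sq_abs (l - r)]; exact pow_le_pow_left₀ ht h 2
  exact div_nonpos_of_nonpos_of_nonneg (by linarith) (by positivity)

theorem coneRatio_neg {r t l : ℝ} (hr : 0 < r) (hl : 0 < l) (ht : 0 ≤ t) (h : t < |l - r|) :
    coneRatio r t l < 0 := by
  have : t ^ 2 < (l - r) ^ 2 := by
    rw [← sq_abs (l - r)]; exact pow_lt_pow_left₀ h ht two_ne_zero
  exact div_neg_of_neg_of_pos (by linarith) (by positivity)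

theorem continuousOn_coneRatio (r t : ℝ) (hr : 0 < r) : ContinuousOn (coneRatio r t) (Ioi 0) := by
  unfold coneRatio
  refine ContinuousOn.div (by fun_prop) (by fun_prop) fun l (hl : 0 < l) => by positivity

theorem hasDerivAt_coneRatio {r l : ℝ} (hr : 0 < r) (hl : 0 < l) (t : ℝ) :
    HasDerivAt (fun τ => coneRatio r τ l) (t / (2 * r * l)) t := by
  have h := (((hasDerivAt_id t).pow 2).sub_const ((l - r) ^ 2)).div_const (4 * r * l)
  refine h.congr_deriv ?_
  simp only [id]
  field_simp
  ring

/-- Integration over the whole base of the cone with the truncated ratio. -/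
theorem integral_cone_eq {r t : ℝ} (hr : 0 < r) (ht : t ∈ Icc 0 (r / 2)) (χ k : ℝ → ℝ)
    (k0 : k 0 = 0) :
    ∫ l in (r - t)..(r + t), χ l * k (coneRatio r t l) =
      ∫ l in (r / 2)..(3 * r / 2), χ l * k (max (coneRatio r t l) 0) := by
  rw [intervalIntegral.integral_of_le (by linarith [ht.1]),
    intervalIntegral.integral_of_le (by linarith)]
  have h1 : Ioc (r - t) (r + t) ⊆ Ioc (r / 2) (3 * r / 2) :=
    Ioc_subset_Ioc (by linarith [ht.2]) (by linarith [ht.2])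
  refine Eq.trans ?_ (setIntegral_eq_of_subset_of_forall_sdiff_eq_zero (μ := volume)
    (f := fun l => χ l * k (max (coneRatio r t l) 0)) measurableSet_Ioc h1 ?_).symm
  · refine setIntegral_congr_fun measurableSet_Ioc fun l hl => ?_
    have hl0 : 0 < l := by linarith [(h1 hl).1]
    rw [max_eq_left]
    exact coneRatio_nonneg hr hl0 (abs_le.2 ⟨by linarith [hl.1], by linarith [hl.2]⟩)
  · rintro l ⟨hl, hl'⟩
    have hl0 : 0 < l := by linarith [hl.1]
    rw [max_eq_right, k0, mul_zero]
    refine coneRatio_nonpos hr hl0 ht.1 ?_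
    by_contra h
    rw [not_le, abs_lt] at h
    exact hl' ⟨by linarith [h.1], by linarith [h.2]⟩

/-- Because k vanishes at 0, the moving endpoints can be traded for a fixed interval by truncating
the ratio at 0. The truncated integrand is Lipschitz in t, and differentiable except at l = r ± t,
so dominated differentiation applies and no boundary terms arise. The factor t/(2rl) is the
t-derivative of the ratio. -/
theorem hasDerivAt_integral_cone {r t : ℝ} (hr : 0 < r) (ht : t ∈ Ioo 0 (r / 2)) {χ k : ℝ → ℝ}
    (hχ : ContinuousOn χ (Ioi 0)) (hk : ContDiffOn ℝ 1 k (Iio 1)) (k0 : k 0 = 0) :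
    HasDerivAt (fun τ => ∫ l in (r - τ)..(r + τ), χ l * k (coneRatio r τ l))
      (t * ∫ l in (r - t)..(r + t), χ l / (2 * r * l) * deriv k (coneRatio r t l)) t := by
  have hsub : uIcc (r / 2) (3 * r / 2) ⊆ Ioi 0 := by
    rw [uIcc_of_le (by linarith)]
    intro l hl
    exact lt_of_lt_of_le (by linarith) hl.1
  have hmem : ∀ l ∈ uIoc (r / 2) (3 * r / 2), r / 2 ≤ l ∧ 0 < l := by
    intro l hl
    rw [uIoc_of_le (by linarith)] at hl
    exact ⟨hl.1.le, by linarith [hl.1]⟩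
  have hnhds : Ioo 0 (r / 2) ∈ 𝓝 t := Ioo_mem_nhds ht.1 ht.2
  have hkc : ContinuousOn k (Iio 1) := hk.continuousOn
  have hk' : ContinuousOn (deriv k) (Iio 1) := hk.continuousOn_deriv_of_isOpen isOpen_Iio le_rfl
  have hkd : ∀ z < 1, HasDerivAt k (deriv k z) z := fun z hz =>
    ((hk.differentiableOn one_ne_zero).differentiableAt (Iio_mem_nhds hz)).hasDerivAt
  have hcont : ∀ τ ∈ Ioo 0 (r / 2), ContinuousOn
      (fun l => χ l * k (max (coneRatio r τ l) 0)) (uIcc (r / 2) (3 * r / 2)) := by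
    intro τ hτ
    refine (hχ.mono hsub).mul (hkc.comp
      (((continuousOn_coneRatio r τ hr).mono hsub).sup continuousOn_const) ?_)
    intro l hl
    rw [uIcc_of_le (by linarith)] at hl
    exact max_lt (coneRatio_lt_one hr (Ioo_subset_Icc_self hτ) hl.1) one_pos
  -- All truncated ratios lie in [0, 1/8], by `coneRatio_le`, so one Lipschitz constant of k on this
  -- compact interval serves for all l.
  obtain ⟨L, hL⟩ := (hk.mono (fun z (hz : z ∈ Icc (0 : ℝ) (1 / 8)) =>
    lt_of_le_of_lt hz.2 (by norm_num : (1 / 8 : ℝ) < 1))).exists_lipschitzOnWith one_ne_zero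
      (convex_Icc _ _) isCompact_Icc
  set F' : ℝ → ℝ := indicator (Ioc (r - t) (r + t))
    (fun l => t * (χ l / (2 * r * l) * deriv k (coneRatio r t l))) with hF'
  have hsubt : Icc (r - t) (r + t) ⊆ Icc (r / 2) (3 * r / 2) :=
    Icc_subset_Icc (by linarith [ht.2]) (by linarith [ht.2])
  have hF'c : ContinuousOn (fun l => t * (χ l / (2 * r * l) * deriv k (coneRatio r t l)))
      (uIcc (r / 2) (3 * r / 2)) := by
    refine continuousOn_const.mul (((hχ.mono hsub).div (by fun_prop) fun l hl => ?_).mul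
      (hk'.comp ((continuousOn_coneRatio r t hr).mono hsub) fun l hl => ?_))
    · have : 0 < l := hsub hl
      positivity
    · rw [uIcc_of_le (by linarith)] at hl
      exact coneRatio_lt_one hr (Ioo_subset_Icc_self ht) hl.1
  have hmain := (intervalIntegral.hasDerivAt_integral_of_dominated_loc_of_lip (μ := volume)
    (a := r / 2) (b := 3 * r / 2) (x₀ := t)
    (F := fun τ l => χ l * k (max (coneRatio r τ l) 0)) (F' := F')
    (bound := fun l => |χ l| * (L / r)) hnhds ?_ ?_ ?_ ?_ ?_ ?_).2
  · have h1 : ∫ l in (r / 2)..(3 * r / 2), F' l =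
        t * ∫ l in (r - t)..(r + t), χ l / (2 * r * l) * deriv k (coneRatio r t l) := by
      rw [intervalIntegral.integral_of_le (by linarith), hF',
        setIntegral_indicator measurableSet_Ioc, inter_eq_self_of_subset_right
        (Ioc_subset_Ioc (by linarith [ht.2]) (by linarith [ht.2])),
        ← intervalIntegral.integral_of_le (by linarith [ht.1]),
        intervalIntegral.integral_const_mul]
    rw [h1] at hmain
    refine hmain.congr_of_eventuallyEq ?_
    filter_upwards [hnhds] with τ hτ
    exact integral_cone_eq hr (Ioo_subset_Icc_self hτ) χ k k0
  · filter_upwards [hnhds] with τ hτ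
    exact ((hcont τ hτ).mono uIoc_subset_uIcc).aestronglyMeasurable measurableSet_uIoc
  · exact (hcont t ht).intervalIntegrable
  · refine AEStronglyMeasurable.indicator ?_ measurableSet_Ioc
    exact (hF'c.mono uIoc_subset_uIcc).aestronglyMeasurable measurableSet_uIoc
  · refine Filter.Eventually.of_forall fun l hl => ?_
    obtain ⟨hl1, hl0⟩ := hmem l hl
    have hb : 0 ≤ |χ l| * (L / r) := by positivity
    refine LipschitzOnWith.of_dist_le_mul fun τ hτ τ' hτ' => ?_
    have hz : ∀ τ ∈ Ioo 0 (r / 2), max (coneRatio r τ l) 0 ∈ Icc (0 : ℝ) (1 / 8) := fun τ hτ =>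
      ⟨le_max_right _ _, max_le (coneRatio_le hr (Ioo_subset_Icc_self hτ) hl1) (by norm_num)⟩
    have h1 := hL.dist_le_mul _ (hz τ hτ) _ (hz τ' hτ')
    have h2 : dist (max (coneRatio r τ l) 0) (max (coneRatio r τ' l) 0) ≤ 1 / r * dist τ τ' := by
      rw [Real.dist_eq, Real.dist_eq]
      refine (abs_max_sub_max_le_abs _ _ _).trans ?_
      have : coneRatio r τ l - coneRatio r τ' l = (τ + τ') / (4 * r * l) * (τ - τ') := by
        unfold coneRatio
        field_simp
        ring
      rw [this, abs_mul, abs_of_nonneg (div_nonneg (by linarith [hτ.1, hτ'.1]) (by positivity))]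
      refine mul_le_mul_of_nonneg_right ?_ (abs_nonneg _)
      rw [div_le_div_iff₀ (by positivity) hr]
      nlinarith [hτ.2, hτ'.2]
    rw [Real.coe_nnabs, abs_of_nonneg hb, Real.dist_eq, ← mul_sub, abs_mul, ← Real.dist_eq,
      mul_assoc]
    refine mul_le_mul_of_nonneg_left (h1.trans ?_) (abs_nonneg _)
    refine (mul_le_mul_of_nonneg_left h2 L.coe_nonneg).trans_eq ?_
    ring
  · refine ContinuousOn.intervalIntegrable ?_
    exact (hχ.mono hsub).abs.mul continuousOn_const
  -- The truncation has its kink at these two points; away from them the sign of the ratio is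
  -- constant for τ near t.
  · have hae : ∀ᵐ l : ℝ, l ≠ r - t ∧ l ≠ r + t :=
      (Measure.ae_ne volume _).and (Measure.ae_ne volume _)
    filter_upwards [hae] with l hne hl
    obtain ⟨hl1, hl0⟩ := hmem l hl
    have hcd := hasDerivAt_coneRatio hr hl0 t
    by_cases hlt : l ∈ Ioc (r - t) (r + t)
    · have hlt' : |l - r| < t := abs_lt.2 ⟨by linarith [hlt.1],
        by linarith [lt_of_le_of_ne hlt.2 hne.2]⟩
      have hpos := coneRatio_pos hr hl0 hlt'
      have hev : ∀ᶠ τ in 𝓝 t, 0 < coneRatio r τ l := hcd.continuousAt.eventually_const_lt hpos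
      have h := ((hkd _ (coneRatio_lt_one hr (Ioo_subset_Icc_self ht) hl1)).comp t hcd).const_mul
        (χ l)
      rw [hF', indicator_of_mem hlt]
      refine (h.congr_deriv (by field_simp)).congr_of_eventuallyEq ?_
      filter_upwards [hev] with τ hτ
      simp [max_eq_left hτ.le]
    · have hlt' : t < |l - r| := by
        by_contra h
        rw [not_lt, abs_le] at h
        refine hlt ⟨lt_of_le_of_ne (by linarith [h.1]) hne.1.symm, by linarith [h.2]⟩
      have hneg := coneRatio_neg hr hl0 ht.1.le hlt'
      have hev : ∀ᶠ τ in 𝓝 t, coneRatio r τ l < 0 := hcd.continuousAt.eventually_lt_const hneg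
      rw [hF', indicator_of_notMem hlt]
      refine (hasDerivAt_const t (0 : ℝ)).congr_of_eventuallyEq ?_
      filter_upwards [hev] with τ hτ
      simp [max_eq_right hτ.le, k0]

theorem invTimeDeriv_iterate_congr {s : Set ℝ} (hs : IsOpen s) (N : ℕ) {h₁ h₂ : ℝ → ℝ}
    (h : EqOn h₁ h₂ s) : EqOn (invTimeDeriv^[N] h₁) (invTimeDeriv^[N] h₂) s := by
  induction N generalizing h₁ h₂ with
  | zero => exact h
  | succ N ih =>
    simp only [Function.iterate_succ, Function.comp]
    refine ih fun t ht => ?_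
    simp only [invTimeDeriv]
    rw [(h.eventuallyEq_of_mem (hs.mem_nhds ht)).deriv_eq]

theorem invTimeDeriv_iterate_const_mul (N : ℕ) (c : ℝ) (h : ℝ → ℝ) :
    invTimeDeriv^[N] (fun t => c * h t) = fun t => c * invTimeDeriv^[N] h t := by
  induction N generalizing h with
  | zero => rfl
  | succ N ih =>
    simp only [Function.iterate_succ, Function.comp]
    rw [← ih]
    congr 1
    funext t
    simp only [invTimeDeriv, deriv_const_mul_field]
    ring

/-- Applying `(1/t) ∂/∂t` repeatedly to a cone integral whose kernel vanishes to the corresponding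
order on the boundary of the cone. -/
theorem exists_invTimeDeriv_iterate_integral_cone (N : ℕ) {κ : ℝ → ℝ}
    (hκ : ContDiffOn ℝ ∞ κ (Iio 1)) : ∃ K : ℝ → ℝ, ContDiffOn ℝ ∞ K (Iio 1) ∧
      ∀ (r : ℝ) (χ : ℝ → ℝ), 0 < r → ContinuousOn χ (Ioi 0) → ∀ t ∈ Ioo 0 (r / 2),
        (invTimeDeriv^[N] fun τ => ∫ l in (r - τ)..(r + τ),
          χ l * (coneRatio r τ l ^ N * κ (coneRatio r τ l))) t =
        ∫ l in (r - t)..(r + t), χ l / (2 * r * l) ^ N * K (coneRatio r t l) := by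
  induction N generalizing κ with
  | zero => exact ⟨κ, hκ, fun r χ _ _ t _ => by simp⟩
  | succ N ih =>
    have hd := (contDiffOn_infty_iff_deriv_of_isOpen isOpen_Iio).1 hκ
    -- This is the new smooth factor: (z^{N+1} κ)' = z^N ((N+1)κ + zκ'). The t of the chain rule
    -- cancels the 1/t of the operator.
    have hκ' : ContDiffOn ℝ ∞ (fun z => ((N : ℝ) + 1) * κ z + z * deriv κ z) (Iio 1) :=
      (contDiffOn_const.mul hκ).add (contDiffOn_id.mul hd.2)
    obtain ⟨K, hK, hrep⟩ := ih hκ'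
    refine ⟨K, hK, fun r χ hr hχ t ht => ?_⟩
    have hχ' : ContinuousOn (fun l => χ l / (2 * r * l)) (Ioi 0) :=
      hχ.div (by fun_prop) fun l (hl : 0 < l) => by positivity
    have hk : ContDiffOn ℝ 1 (fun z : ℝ => z ^ (N + 1) * κ z) (Iio 1) :=
      ((contDiffOn_id.pow _).mul hκ).of_le (by simp)
    rw [Function.iterate_succ, Function.comp]
    have heq : EqOn (invTimeDeriv fun τ => ∫ l in (r - τ)..(r + τ),
        χ l * (coneRatio r τ l ^ (N + 1) * κ (coneRatio r τ l)))
        (fun τ => ∫ l in (r - τ)..(r + τ), χ l / (2 * r * l) * (coneRatio r τ l ^ N *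
          (((N : ℝ) + 1) * κ (coneRatio r τ l) + coneRatio r τ l * deriv κ (coneRatio r τ l))))
        (Ioo 0 (r / 2)) := by
      intro τ hτ
      have h := hasDerivAt_integral_cone hr hτ hχ hk (by simp)
      simp only [invTimeDeriv]
      rw [h.deriv, one_div, inv_mul_cancel_left₀ hτ.1.ne']
      refine intervalIntegral.integral_congr fun l hl => ?_
      rw [uIcc_of_le (by linarith [hτ.1])] at hl
      have hz : coneRatio r τ l < 1 := coneRatio_lt_one hr (Ioo_subset_Icc_self hτ)
        (by linarith [hl.1, hτ.2])
      have hκd := (hd.1.differentiableAt (Iio_mem_nhds hz)).hasDerivAt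
      have hp := (((hasDerivAt_id (coneRatio r τ l)).pow (N + 1)).mul hκd).deriv
      congr 1
      refine Eq.trans hp ?_
      simp only [id, Pi.pow_apply, add_tsub_cancel_right]
      push_cast
      ring
    rw [invTimeDeriv_iterate_congr isOpen_Ioo N heq ht, hrep r _ hr hχ' t ht]
    refine intervalIntegral.integral_congr fun l _ => ?_
    rw [div_div, pow_succ' (2 * r * l)]

end HartreeWave

/-! ### The even-dimensional kernel and the descent substitution -/

namespace HartreeWave

open scoped ENNReal ContDiff Topology

/-- The integral `∫_0^{π/2} sin^{2j} θ (1 - z sin² θ)^p dθ`. -/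
def sinIntegral (j : ℕ) (p z : ℝ) : ℝ :=
  ∫ θ in (0 : ℝ)..Real.pi / 2, (Real.sin θ ^ 2) ^ j * (1 - z * Real.sin θ ^ 2) ^ p

theorem one_sub_mul_sin_sq_pos {z : ℝ} (hz : z < 1) (θ : ℝ) : 0 < 1 - z * Real.sin θ ^ 2 := by
  rcases le_or_gt z 0 with h | h
  · nlinarith [sq_nonneg (Real.sin θ)]
  · nlinarith [Real.sin_sq_le_one θ]

theorem continuousOn_sinIntegrand (j : ℕ) (p : ℝ) :
    ContinuousOn (fun q : ℝ × ℝ => (Real.sin q.2 ^ 2) ^ j * (1 - q.1 * Real.sin q.2 ^ 2) ^ p)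
      (Iio 1 ×ˢ univ) := by
  refine ContinuousOn.mul (by fun_prop) (ContinuousOn.rpow_const (by fun_prop) ?_)
  rintro ⟨z, θ⟩ ⟨hz, -⟩
  exact Or.inl (one_sub_mul_sin_sq_pos hz θ).ne'

theorem continuous_sinIntegrand (j : ℕ) (p : ℝ) {z : ℝ} (hz : z < 1) :
    Continuous (fun θ : ℝ => (Real.sin θ ^ 2) ^ j * (1 - z * Real.sin θ ^ 2) ^ p) :=
  (continuousOn_sinIntegrand j p).comp_continuous (f := fun θ : ℝ => (z, θ)) (by fun_prop)
    fun _ => ⟨hz, mem_univ _⟩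

/-- The derivative stays in the same two-parameter family, so smoothness follows by induction on the
order with j and p left free. -/
theorem hasDerivAt_sinIntegral (j : ℕ) (p : ℝ) {z : ℝ} (hz : z < 1) :
    HasDerivAt (sinIntegral j p) (-p * sinIntegral (j + 1) (p - 1) z) z := by
  set s := Ioo (z - 1) ((z + 1) / 2) with hs
  have hs1 : ∀ x ∈ Icc (z - 1) ((z + 1) / 2), x < 1 := fun x hx => by linarith [hx.2]
  -- The upper end (z+1)/2 stays strictly below 1, so the base of the real power is bounded away
  -- from 0 and the derivative is uniformly bounded.
  obtain ⟨C, hC⟩ := ((isCompact_Icc (a := z - 1) (b := (z + 1) / 2)).prod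
    (isCompact_Icc (a := (0 : ℝ)) (b := Real.pi / 2))).exists_bound_of_continuousOn
      ((continuousOn_sinIntegrand (j + 1) (p - 1)).mono
        (prod_mono (fun x hx => hs1 x hx) (subset_univ _)))
  have h := (intervalIntegral.hasDerivAt_integral_of_dominated_loc_of_deriv_le (μ := volume)
    (a := 0) (b := Real.pi / 2) (x₀ := z) (s := s)
    (F := fun z θ => (Real.sin θ ^ 2) ^ j * (1 - z * Real.sin θ ^ 2) ^ p)
    (F' := fun z θ => -p * ((Real.sin θ ^ 2) ^ (j + 1) * (1 - z * Real.sin θ ^ 2) ^ (p - 1)))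
    (bound := fun _ => |p| * C) (Ioo_mem_nhds (by linarith) (by linarith)) ?_ ?_ ?_ ?_ ?_ ?_).2
  · rwa [intervalIntegral.integral_const_mul] at h
  · filter_upwards [Iio_mem_nhds hz] with x hx
    exact (continuous_sinIntegrand j p hx).aestronglyMeasurable
  · exact (continuous_sinIntegrand j p hz).intervalIntegrable _ _
  · exact (continuous_const.mul (continuous_sinIntegrand (j + 1) (p - 1) hz)).aestronglyMeasurable
  · refine Filter.Eventually.of_forall fun θ hθ x hx => ?_
    rw [uIoc_of_le (by positivity)] at hθ
    rw [norm_mul, norm_neg, Real.norm_eq_abs]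
    exact mul_le_mul_of_nonneg_left
      (hC (x, θ) ⟨Ioo_subset_Icc_self hx, Ioc_subset_Icc_self hθ⟩) (abs_nonneg _)
  · exact intervalIntegrable_const
  · refine Filter.Eventually.of_forall fun θ hθ x hx => ?_
    have hx1 := hs1 x (Ioo_subset_Icc_self hx)
    have h1 := ((((hasDerivAt_id x).mul_const (Real.sin θ ^ 2)).const_sub 1).rpow_const (p := p)
      (Or.inl (one_sub_mul_sin_sq_pos hx1 θ).ne')).const_mul ((Real.sin θ ^ 2) ^ j)
    refine h1.congr_deriv ?_
    simp only [id]
    ring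

theorem contDiffOn_sinIntegral (j : ℕ) (p : ℝ) : ContDiffOn ℝ ∞ (sinIntegral j p) (Iio 1) := by
  rw [contDiffOn_infty]
  intro N
  induction N generalizing j p with
  | zero =>
    exact contDiffOn_zero.2 fun z hz => (hasDerivAt_sinIntegral j p hz).continuousAt.continuousWithinAt
  | succ N ih =>
    have : ((N + 1 : ℕ) : WithTop ℕ∞) = (N : WithTop ℕ∞) + 1 := by norm_cast
    rw [this, contDiffOn_succ_iff_deriv_of_isOpen isOpen_Iio]
    refine ⟨fun z hz => (hasDerivAt_sinIntegral j p hz).differentiableAt.differentiableWithinAt,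
      by simp, ?_⟩
    refine (contDiffOn_const (c := -p)).mul (ih (j + 1) (p - 1)) |>.congr fun z hz => ?_
    exact (hasDerivAt_sinIntegral j p hz).deriv

/-- The product of the two brackets is Heron's expression, symmetric in the three sides of the
triangle; here ρ and l exchange roles, so that the cone variable appears. -/
theorem sphericalKernel_eq (n : ℕ) {r ρ l : ℝ} (hl : l ∈ Icc |ρ - r| (ρ + r)) :
    sphericalKernel n l ρ r =
      ((ρ ^ 2 - (l - r) ^ 2) * ((l + r) ^ 2 - ρ ^ 2)) ^ (((n : ℝ) - 3) / 2) := by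
  have h0 : 0 ≤ l := (abs_nonneg _).trans hl.1
  have h1 : (ρ - r) ^ 2 ≤ l ^ 2 := by rw [← sq_abs]; exact pow_le_pow_left₀ (abs_nonneg _) hl.1 2
  have h2 : l ^ 2 ≤ (ρ + r) ^ 2 := pow_le_pow_left₀ h0 hl.2 2
  rw [sphericalKernel, ← Real.mul_rpow (by linarith) (by linarith)]
  congr 1
  ring

section Descent

/-- The substitution `t² ρ² = a² + (t² - a²) sin² θ`. -/
def descentRadius (a t θ : ℝ) : ℝ := Real.sqrt (a ^ 2 + (t ^ 2 - a ^ 2) * Real.sin θ ^ 2) / t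

variable {a t : ℝ}

theorem descentRadius_radicand_pos (ha : 0 ≤ a) (hat : a < t) {θ : ℝ}
    (hθ : θ ∈ Ioo 0 (Real.pi / 2)) : 0 < a ^ 2 + (t ^ 2 - a ^ 2) * Real.sin θ ^ 2 := by
  have h1 := Real.sin_pos_of_pos_of_lt_pi hθ.1 (by linarith [hθ.2, Real.pi_pos])
  have h2 : a ^ 2 < t ^ 2 := pow_lt_pow_left₀ hat ha two_ne_zero
  have h3 : 0 < (t ^ 2 - a ^ 2) * Real.sin θ ^ 2 := mul_pos (by linarith) (by positivity)
  positivity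

theorem descentRadius_pos (ha : 0 ≤ a) (hat : a < t) {θ : ℝ} (hθ : θ ∈ Ioo 0 (Real.pi / 2)) :
    0 < descentRadius a t θ :=
  div_pos (Real.sqrt_pos.2 (descentRadius_radicand_pos ha hat hθ)) (ha.trans_lt hat)

theorem descentRadius_sq (ha : 0 ≤ a) (hat : a < t) {θ : ℝ} (hθ : θ ∈ Ioo 0 (Real.pi / 2)) :
    (t * descentRadius a t θ) ^ 2 = a ^ 2 + (t ^ 2 - a ^ 2) * Real.sin θ ^ 2 := by
  have ht : 0 < t := ha.trans_lt hat
  rw [descentRadius, mul_div_cancel₀ _ ht.ne',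
    Real.sq_sqrt (descentRadius_radicand_pos ha hat hθ).le]

theorem descentRadius_injOn (ha : 0 ≤ a) (hat : a < t) :
    InjOn (descentRadius a t) (Ioo 0 (Real.pi / 2)) := by
  intro θ hθ θ' hθ' h
  have h2 : a ^ 2 < t ^ 2 := pow_lt_pow_left₀ hat ha two_ne_zero
  have h1 := descentRadius_sq ha hat hθ
  rw [h, descentRadius_sq ha hat hθ'] at h1
  have h3 : Real.sin θ ^ 2 = Real.sin θ' ^ 2 := by
    apply mul_left_cancel₀ (sub_pos.2 h2).ne'
    linarith
  have h4 := Real.sin_pos_of_pos_of_lt_pi hθ.1 (by linarith [hθ.2, Real.pi_pos])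
  have h5 := Real.sin_pos_of_pos_of_lt_pi hθ'.1 (by linarith [hθ'.2, Real.pi_pos])
  have h6 : Real.sin θ = Real.sin θ' := by
    rwa [pow_left_inj₀ h4.le h5.le two_ne_zero] at h3
  exact Real.injOn_sin ⟨by linarith [hθ.1, Real.pi_pos], hθ.2.le⟩
    ⟨by linarith [hθ'.1, Real.pi_pos], hθ'.2.le⟩ h6

theorem descentRadius_image (ha : 0 ≤ a) (hat : a < t) :
    descentRadius a t '' Ioo 0 (Real.pi / 2) = Ioo (a / t) 1 := by
  have ht : 0 < t := ha.trans_lt hat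
  have h2 : a ^ 2 < t ^ 2 := pow_lt_pow_left₀ hat ha two_ne_zero
  ext ρ
  constructor
  · rintro ⟨θ, hθ, rfl⟩
    have h4 := Real.sin_pos_of_pos_of_lt_pi hθ.1 (by linarith [hθ.2, Real.pi_pos])
    have h5 := Real.cos_pos_of_mem_Ioo ⟨by linarith [hθ.1, Real.pi_pos], hθ.2⟩
    have h6 := Real.sin_sq_add_cos_sq θ
    have h7 : 0 < (t ^ 2 - a ^ 2) * Real.sin θ ^ 2 := mul_pos (by linarith) (by positivity)
    have h8 : 0 < (t ^ 2 - a ^ 2) * Real.cos θ ^ 2 := mul_pos (by linarith) (by positivity)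
    constructor
    · exact div_lt_div_of_pos_right (Real.lt_sqrt_of_sq_lt (by linarith)) ht
    · rw [descentRadius, div_lt_one ht, Real.sqrt_lt' ht]
      nlinarith
  · rintro ⟨h3, h4⟩
    rw [div_lt_iff₀ ht] at h3
    have hρ : 0 < ρ := pos_of_mul_pos_left (ha.trans_lt h3) ht.le
    have h5 : a ^ 2 < (ρ * t) ^ 2 := pow_lt_pow_left₀ h3 ha two_ne_zero
    have h6 : (ρ * t) ^ 2 < t ^ 2 :=
      pow_lt_pow_left₀ (by nlinarith) (by positivity) two_ne_zero
    set c := Real.sqrt (((ρ * t) ^ 2 - a ^ 2) / (t ^ 2 - a ^ 2)) with hc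
    have hc0 : 0 < c := Real.sqrt_pos.2 (div_pos (by linarith) (by linarith))
    have hc1 : c < 1 := by
      rw [hc, Real.sqrt_lt' one_pos, div_lt_iff₀ (by linarith)]
      linarith
    have hc2 : c ^ 2 = ((ρ * t) ^ 2 - a ^ 2) / (t ^ 2 - a ^ 2) :=
      Real.sq_sqrt (div_pos (by linarith) (by linarith)).le
    refine ⟨Real.arcsin c, ⟨Real.arcsin_pos.2 hc0, Real.arcsin_lt_pi_div_two.2 hc1⟩, ?_⟩
    rw [descentRadius, Real.sin_arcsin (by linarith) hc1.le, hc2,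
      mul_div_cancel₀ _ (sub_pos.2 h2).ne', add_sub_cancel, Real.sqrt_sq (by positivity),
      mul_div_cancel_right₀ _ ht.ne']

theorem hasDerivAt_descentRadius (ha : 0 ≤ a) (hat : a < t) {θ : ℝ}
    (hθ : θ ∈ Ioo 0 (Real.pi / 2)) : HasDerivAt (descentRadius a t)
      ((t ^ 2 - a ^ 2) * (Real.sin θ * Real.cos θ) / (t ^ 2 * descentRadius a t θ)) θ := by
  have ht : 0 < t := ha.trans_lt hat
  have h := (((((Real.hasDerivAt_sin θ).pow 2).const_mul (t ^ 2 - a ^ 2)).const_add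
    (a ^ 2)).sqrt (descentRadius_radicand_pos ha hat hθ).ne').div_const t
  refine h.congr_deriv ?_
  have h1 : √(a ^ 2 + (t ^ 2 - a ^ 2) * Real.sin θ ^ 2) = t * descentRadius a t θ := by
    rw [descentRadius, mul_div_cancel₀ _ ht.ne']
  have h2 := descentRadius_pos ha hat hθ
  simp only [Pi.pow_apply]
  rw [h1]
  field_simp
  ring

/-- The radial integral arising in the method of descent. -/
theorem lintegral_descent (ha : 0 ≤ a) (hat : a < t) {j : ℕ} {p β : ℝ} (hp : p = (j : ℝ) - 1 / 2)
    (hβ : t ^ 2 - a ^ 2 < β) :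
    ∫⁻ ρ in Ioo (a / t) 1, ENNReal.ofReal (ρ / Real.sqrt (1 - ρ ^ 2) *
      (((t * ρ) ^ 2 - a ^ 2) * (β + a ^ 2 - (t * ρ) ^ 2)) ^ p) =
    ENNReal.ofReal (t⁻¹ * (t ^ 2 - a ^ 2) ^ j * β ^ p *
      sinIntegral j p ((t ^ 2 - a ^ 2) / β)) := by
  have ht : 0 < t := ha.trans_lt hat
  have h2 : 0 < t ^ 2 - a ^ 2 := sub_pos.2 (pow_lt_pow_left₀ hat ha two_ne_zero)
  have hβ0 : 0 < β := h2.trans hβ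
  have hz : (t ^ 2 - a ^ 2) / β < 1 := (div_lt_one hβ0).2 hβ
  rw [← descentRadius_image ha hat, lintegral_image_eq_lintegral_abs_deriv_mul measurableSet_Ioo
    (fun θ hθ => (hasDerivAt_descentRadius ha hat hθ).hasDerivWithinAt) (descentRadius_injOn ha hat),
    sinIntegral, ← intervalIntegral.integral_const_mul, intervalIntegral.integral_of_le (by positivity),
    integral_Ioc_eq_integral_Ioo, ofReal_integral_eq_lintegral_ofReal]
  · refine setLIntegral_congr_fun measurableSet_Ioo fun θ hθ => ?_
    rw [← ENNReal.ofReal_mul (abs_nonneg _)]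
    congr 1
    have hρ := descentRadius_pos ha hat hθ
    have hs := Real.sin_pos_of_pos_of_lt_pi hθ.1 (by linarith [hθ.2, Real.pi_pos])
    have hc := Real.cos_pos_of_mem_Ioo ⟨by linarith [hθ.1, Real.pi_pos], hθ.2⟩
    have hsc := Real.sin_sq_add_cos_sq θ
    have hsq := descentRadius_sq ha hat hθ
    set ρ := descentRadius a t θ
    set w := t ^ 2 - a ^ 2
    have h3 : Real.sqrt (1 - ρ ^ 2) = Real.sqrt w * Real.cos θ / t := by
      rw [← Real.sqrt_sq (by positivity : 0 ≤ Real.sqrt w * Real.cos θ / t)]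
      congr 1
      rw [div_pow, mul_pow, Real.sq_sqrt h2.le, eq_div_iff (by positivity)]
      have : t ^ 2 - a ^ 2 = w := rfl
      linear_combination (-1) * hsq + this + w * (-hsc)
    have h4 : 1 - w / β * Real.sin θ ^ 2 = (β - w * Real.sin θ ^ 2) / β := by field_simp
    have h5 : 0 < β - w * Real.sin θ ^ 2 := by nlinarith [Real.sin_sq_le_one θ]
    -- As p = j - 1/2, the square root left by the substitution completes the half-integer power to
    -- an integer one.
    have hj : Real.sqrt w * w ^ p = w ^ j := by
      rw [Real.sqrt_eq_rpow, ← Real.rpow_add h2, ← Real.rpow_natCast]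
      congr 1
      rw [hp]; ring
    have hj' : Real.sin θ * (Real.sin θ ^ 2) ^ p = (Real.sin θ ^ 2) ^ j := by
      nth_rewrite 1 [← Real.sqrt_sq hs.le]
      rw [Real.sqrt_eq_rpow, ← Real.rpow_add (by positivity),
        ← Real.rpow_natCast (Real.sin θ ^ 2) j]
      congr 1
      rw [hp]; ring
    rw [abs_of_pos (by positivity), h3, hsq, add_sub_cancel_left, h4,
      show β + a ^ 2 - (a ^ 2 + w * Real.sin θ ^ 2) = β - w * Real.sin θ ^ 2 by ring,
      Real.mul_rpow (by positivity) h5.le, Real.mul_rpow h2.le (by positivity),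
      Real.div_rpow h5.le hβ0.le, ← hj, ← hj']
    have hβp : 0 < β ^ p := by positivity
    have hw' : 0 < √w := Real.sqrt_pos.2 h2
    have hw2 : √w ^ 2 = w := Real.sq_sqrt h2.le
    generalize w ^ p = P1
    generalize (Real.sin θ ^ 2) ^ p = P2
    generalize (β - w * Real.sin θ ^ 2) ^ p = P3
    field_simp
    linear_combination (-P1 * P2 * P3) * hw2
  · refine IntegrableOn.mono_set ?_ Ioo_subset_Icc_self
    exact (continuous_const.mul (continuous_sinIntegrand j p hz)).continuousOn.integrableOn_Icc
  · refine Filter.Eventually.of_forall fun θ => ?_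
    have := (one_sub_mul_sin_sq_pos hz θ).le
    simp only [Pi.zero_apply]
    positivity

end Descent

end HartreeWave

/-! ### The means of radial functions through densities -/

namespace HartreeWave

open scoped ENNReal Topology

theorem sphereDensity_eq {n : ℕ} (hn : 2 ≤ n) {r ρ l : ℝ} (hr : 0 < r) (hρ : 0 < ρ)
    (hl : l ∈ Icc |ρ - r| (ρ + r)) :
    sphereDensity n r ρ l = sphereArea (n - 1) * 2 ^ (3 - (n : ℝ)) / r ^ (n - 2) / ρ ^ (n - 2) * l *
      ((ρ ^ 2 - (l - r) ^ 2) * ((l + r) ^ 2 - ρ ^ 2)) ^ (((n : ℝ) - 3) / 2) := by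
  rw [sphereDensity, sphericalKernel_eq n hl, mul_assoc 2 r ρ, Real.mul_rpow (by norm_num) (by positivity)]
  have h : (r * ρ) ^ (3 - (n : ℝ)) * (r * ρ) ^ (n - 2) = r * ρ := by
    rw [← Real.rpow_natCast, ← Real.rpow_add (by positivity)]
    push_cast [Nat.cast_sub hn]
    ring_nf
    rw [Real.rpow_one]
  have h' : (r * ρ) ^ (3 - (n : ℝ)) = r * ρ / (r * ρ) ^ (n - 2) := by
    rw [eq_div_iff (by positivity), h]
  rw [h', mul_pow]
  field_simp

theorem waveMean_of_not_even {n : ℕ} (hn : 2 ≤ n) (he : ¬ Even n) {x : EuclideanSpace ℝ (Fin n)}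
    {t : ℝ} (ht : 0 < t) (htx : t < ‖x‖) {ψ : ℝ → ℝ} (hψ : Measurable ψ) :
    waveMean n (fun y => ψ ‖y‖) x t = ∫ l in Ioo (‖x‖ - t) (‖x‖ + t),
      1 / sphereArea n * sphereDensity n ‖x‖ t l * ψ l := by
  have hx : x ≠ 0 := norm_pos_iff.1 (ht.trans htx)
  rw [waveMean, if_neg he, integral_sphere_norm_add hn hx ht ψ hψ, ← integral_const_mul,
    abs_sub_comm, abs_of_pos (sub_pos.2 htx), add_comm t]
  simp only [mul_assoc]

/-- The density of the weighted mean over balls. -/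
def ballDensity (n : ℕ) (r t l : ℝ) : ℝ :=
  sphereArea (n - 1) * 2 ^ (3 - (n : ℝ)) / r ^ (n - 2) / t ^ (n - 2) * l *
    (t⁻¹ * (t ^ 2 - (l - r) ^ 2) ^ (n / 2 - 1) * (4 * r * l) ^ (((n : ℝ) - 3) / 2) *
      sinIntegral (n / 2 - 1) (((n : ℝ) - 3) / 2) (coneRatio r t l))

theorem coneRatio_lt_one' {r t l : ℝ} (hr : 0 < r) (ht : 0 < t) (htr : t < r) (hl : 0 < l) :
    coneRatio r t l < 1 := by
  rw [coneRatio, div_lt_one (by positivity)]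
  nlinarith

theorem sinIntegral_nonneg (j : ℕ) (p : ℝ) {z : ℝ} (hz : z < 1) : 0 ≤ sinIntegral j p z := by
  refine intervalIntegral.integral_nonneg (by positivity) fun θ _ => ?_
  have := (one_sub_mul_sin_sq_pos hz θ).le
  positivity

theorem ballDensity_nonneg {n : ℕ} (hn : 2 ≤ n) {r t l : ℝ} (hr : 0 < r) (ht : 0 < t) (htr : t < r)
    (hl : l ∈ Ioo (r - t) (r + t)) : 0 ≤ ballDensity n r t l := by
  have hl0 : 0 < l := by linarith [hl.1]
  have h1 := sinIntegral_nonneg (n / 2 - 1) (((n : ℝ) - 3) / 2) (coneRatio_lt_one' hr ht htr hl0)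
  have h2 := sphereArea_pos (k := n - 1) (by omega)
  have h3 : 0 ≤ t ^ 2 - (l - r) ^ 2 := by nlinarith [hl.1, hl.2]
  unfold ballDensity
  positivity

theorem continuousOn_ballDensity {n : ℕ} {r t : ℝ} (hr : 0 < r) (ht : 0 < t) (htr : t < r) :
    ContinuousOn (ballDensity n r t) (Ioo (r - t) (r + t)) := by
  have h0 : ∀ l ∈ Ioo (r - t) (r + t), 0 < l := fun l hl => by linarith [hl.1]
  unfold ballDensity
  refine ContinuousOn.mul (by fun_prop) (ContinuousOn.mul (ContinuousOn.mul (by fun_prop)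
    (ContinuousOn.rpow_const (by fun_prop) fun l hl => Or.inl ?_)) ?_)
  · have := h0 l hl
    positivity
  · exact (contDiffOn_sinIntegral _ _).continuousOn.comp
      ((continuousOn_coneRatio r t hr).mono h0) fun l hl => coneRatio_lt_one' hr ht htr (h0 l hl)

/-- The radial part of the integral over a ball, for fixed distance `l` from the origin. -/
theorem lintegral_ball_radial {n : ℕ} (hn : 2 ≤ n) (he : Even n) {r t l : ℝ} (hr : 0 < r)
    (ht : 0 < t) (htr : t < r) (hl : l ∈ Ioo (r - t) (r + t)) :
    ∫⁻ ρ in Ioo (|l - r| / t) 1, ENNReal.ofReal (ρ ^ (n - 1) / Real.sqrt (1 - ρ ^ 2) *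
      sphereDensity n r (t * ρ) l) = ENNReal.ofReal (ballDensity n r t l) := by
  have hl0 : 0 < l := by linarith [hl.1]
  have h2 := sphereArea_pos (k := n - 1) (by omega)
  have hat : |l - r| < t := abs_lt.2 ⟨by linarith [hl.1], by linarith [hl.2]⟩
  have hp : ((n : ℝ) - 3) / 2 = ((n / 2 - 1 : ℕ) : ℝ) - 1 / 2 := by
    obtain ⟨m, rfl⟩ := he
    have : (m + m) / 2 - 1 = m - 1 := by omega
    rw [this]
    push_cast [Nat.cast_sub (show 1 ≤ m by omega)]
    ring
  have hβ : t ^ 2 - |l - r| ^ 2 < 4 * r * l := by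
    rw [sq_abs]
    nlinarith
  have h := lintegral_descent (abs_nonneg (l - r)) hat hp hβ
  have hc : 0 ≤ sphereArea (n - 1) * 2 ^ (3 - (n : ℝ)) / r ^ (n - 2) / t ^ (n - 2) * l := by
    positivity
  rw [sq_abs] at h
  rw [ballDensity, ENNReal.ofReal_mul hc, coneRatio, ← h,
    ← lintegral_const_mul' _ _ ENNReal.ofReal_ne_top]
  refine setLIntegral_congr_fun measurableSet_Ioo fun ρ hρ => ?_
  have hρ0 : 0 < ρ := (div_nonneg (abs_nonneg _) ht.le).trans_lt hρ.1
  rw [← ENNReal.ofReal_mul hc]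
  congr 1
  have h3 := hρ.1
  rw [div_lt_iff₀ ht, abs_lt] at h3
  have h4 : t * ρ < t := by nlinarith [hρ.2]
  rw [sphereDensity_eq hn hr (by positivity)
    ⟨abs_le.2 ⟨by nlinarith, by nlinarith⟩, by nlinarith⟩,
    show 4 * r * l + (l - r) ^ 2 - (t * ρ) ^ 2 = (l + r) ^ 2 - (t * ρ) ^ 2 by ring, mul_pow t ρ (n - 2),
    show n - 1 = n - 2 + 1 by omega, pow_succ ρ]
  generalize ((t * ρ) ^ 2 - (l - r) ^ 2) * ((l + r) ^ 2 - (t * ρ) ^ 2) = P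
  have h5 : 0 < 1 - ρ ^ 2 := by nlinarith [hρ.2]
  have h6 := Real.sqrt_pos.2 h5
  field_simp

set_option maxHeartbeats 1000000 in
-- Polar coordinates in the ball give, for each radius ρ, the density of |x + tρω|. Tonelli then
-- puts the ρ-integral inside: at fixed l it runs over |l - r|/t < ρ < 1 and is the descent integral
-- of `lintegral_ball_radial`.
theorem lintegral_ball_norm_add {n : ℕ} (hn : 2 ≤ n) (he : Even n) {x : EuclideanSpace ℝ (Fin n)}
    {t : ℝ} (ht : 0 < t) (htx : t < ‖x‖) (f : ℝ → ℝ≥0∞) (hf : Measurable f) :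
    ∫⁻ ξ in Metric.closedBall (0 : EuclideanSpace ℝ (Fin n)) 1,
      ENNReal.ofReal (1 / Real.sqrt (1 - ‖ξ‖ ^ 2)) * f ‖x + t • ξ‖ =
      ∫⁻ l in Ioo (‖x‖ - t) (‖x‖ + t), ENNReal.ofReal (ballDensity n ‖x‖ t l) * f l := by
  have hr : 0 < ‖x‖ := ht.trans htx
  have hx : x ≠ 0 := norm_pos_iff.1 hr
  have : Nonempty (Fin n) := ⟨⟨0, by omega⟩⟩
  set r := ‖x‖ with hrx
  set S : Set (ℝ × ℝ) := {p | 0 < p.1 ∧ p.1 < 1 ∧ |p.2 - r| < t * p.1} with hS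
  have hSm : MeasurableSet S := by
    have h : S = {p : ℝ × ℝ | 0 < p.1} ∩ ({p | p.1 < 1} ∩ {p | |p.2 - r| < t * p.1}) := rfl
    rw [h]
    exact (measurableSet_lt (by fun_prop) (by fun_prop)).inter
      ((measurableSet_lt (by fun_prop) (by fun_prop)).inter
        (measurableSet_lt (by fun_prop) (by fun_prop)))
  have hDm : Measurable fun p : ℝ × ℝ => sphereDensity n r (t * p.1) p.2 :=
    (measurable_sphereDensity n).comp
      (by fun_prop : Measurable fun p : ℝ × ℝ => (r, t * p.1, p.2))
  set A : ℝ × ℝ → ℝ≥0∞ := S.indicator (fun p => ENNReal.ofReal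
    (p.1 ^ (n - 1) / Real.sqrt (1 - p.1 ^ 2) * sphereDensity n r (t * p.1) p.2)) with hA
  have hAm : Measurable A := Measurable.indicator (by fun_prop) hSm
  have h1 : ∫⁻ ξ in Metric.closedBall (0 : EuclideanSpace ℝ (Fin n)) 1,
      ENNReal.ofReal (1 / Real.sqrt (1 - ‖ξ‖ ^ 2)) * f ‖x + t • ξ‖ =
      ∫⁻ ρ : ℝ, ∫⁻ l : ℝ, A (ρ, l) * f l := by
    have hGm : Measurable ((Metric.closedBall (0 : EuclideanSpace ℝ (Fin n)) 1).indicator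
        fun ξ => ENNReal.ofReal (1 / Real.sqrt (1 - ‖ξ‖ ^ 2)) * f ‖x + t • ξ‖) :=
      Measurable.indicator (by fun_prop) Metric.isClosed_closedBall.measurableSet
    rw [← lintegral_indicator Metric.isClosed_closedBall.measurableSet,
      lintegral_polar volume _ hGm, ← lintegral_indicator measurableSet_Ioi]
    -- The radius 1 belongs to the closed ball but not to `S`.
    have hne : ∀ᵐ ρ : ℝ, ρ ≠ 1 := Measure.ae_ne volume _
    refine lintegral_congr_ae ?_
    filter_upwards [hne] with ρ hρ1
    by_cases hρ : 0 < ρ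
    · rw [indicator_of_mem (mem_Ioi.2 hρ)]
      by_cases hρ2 : ρ < 1
      · have h2 : ∀ ω : Metric.sphere (0 : EuclideanSpace ℝ (Fin n)) 1,
            (Metric.closedBall (0 : EuclideanSpace ℝ (Fin n)) 1).indicator (fun ξ =>
              ENNReal.ofReal (1 / Real.sqrt (1 - ‖ξ‖ ^ 2)) * f ‖x + t • ξ‖)
              (ρ • (ω : EuclideanSpace ℝ (Fin n))) =
            ENNReal.ofReal (1 / Real.sqrt (1 - ρ ^ 2)) *
              f ‖x + (t * ρ) • (ω : EuclideanSpace ℝ (Fin n))‖ := by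
          intro ω
          rw [indicator_of_mem, norm_smul, norm_eq_of_mem_sphere, mul_one, Real.norm_of_nonneg hρ.le,
            smul_smul]
          simp [norm_smul, abs_of_pos hρ, hρ2.le]
        simp only [h2]
        have htρ : t * ρ < r := by nlinarith
        rw [lintegral_const_mul _ (by fun_prop), lintegral_sphere_norm_add hn hx (by positivity) f hf,
          ← mul_assoc, ← ENNReal.ofReal_mul (by positivity),
          ← lintegral_const_mul' _ _ ENNReal.ofReal_ne_top, ← lintegral_indicator measurableSet_Ioo]
        refine lintegral_congr fun l => ?_
        rw [← hrx, abs_sub_comm, abs_of_pos (sub_pos.2 htρ)]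
        by_cases hl : |l - r| < t * ρ
        · have hl' := abs_lt.1 hl
          have hl2 : l ∈ Ioo (r - t * ρ) (t * ρ + r) := ⟨by linarith, by linarith⟩
          rw [indicator_of_mem hl2, hA,
            indicator_of_mem (show (ρ, l) ∈ S from ⟨hρ, hρ2, hl⟩), ← mul_assoc,
            ← ENNReal.ofReal_mul (by positivity), finrank_euclideanSpace_fin]
          simp only [mul_one_div]
        · have hl2 : l ∉ Ioo (r - t * ρ) (t * ρ + r) := fun h =>
            hl (abs_lt.2 ⟨by linarith [h.1], by linarith [h.2]⟩)
          rw [indicator_of_notMem hl2, hA, indicator_of_notMem (fun h => hl h.2.2), zero_mul]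
      · have h2 : ∀ ω : Metric.sphere (0 : EuclideanSpace ℝ (Fin n)) 1,
            (Metric.closedBall (0 : EuclideanSpace ℝ (Fin n)) 1).indicator (fun ξ =>
              ENNReal.ofReal (1 / Real.sqrt (1 - ‖ξ‖ ^ 2)) * f ‖x + t • ξ‖)
              (ρ • (ω : EuclideanSpace ℝ (Fin n))) = 0 := by
          intro ω
          refine indicator_of_notMem ?_ _
          have : 1 < ρ := lt_of_le_of_ne (not_lt.1 hρ2) hρ1.symm
          simp [norm_smul, abs_of_pos hρ, this]
        have h3 : ∀ l, A (ρ, l) = 0 := fun l => indicator_of_notMem (fun h => hρ2 h.2.1) _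
        simp only [h2, h3, lintegral_zero, mul_zero, zero_mul]
    · have h3 : ∀ l, A (ρ, l) = 0 := fun l => indicator_of_notMem (fun h => hρ h.1) _
      rw [indicator_of_notMem (show ρ ∉ Ioi 0 from hρ)]
      simp [h3]
  rw [h1, lintegral_lintegral_swap (by fun_prop), ← lintegral_indicator measurableSet_Ioo]
  refine lintegral_congr fun l => ?_
  rw [lintegral_mul_const _ (by fun_prop)]
  by_cases hl : l ∈ Ioo (r - t) (r + t)
  · rw [indicator_of_mem hl, ← lintegral_ball_radial hn he hr ht htx hl,
      ← lintegral_indicator measurableSet_Ioo]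
    congr 1
    refine lintegral_congr fun ρ => ?_
    by_cases hρ : ρ ∈ Ioo (|l - r| / t) 1
    · have hρ0 : 0 < ρ := (div_nonneg (abs_nonneg _) ht.le).trans_lt hρ.1
      have h3 := hρ.1
      rw [div_lt_iff₀' ht] at h3
      rw [indicator_of_mem hρ, hA, indicator_of_mem (show (ρ, l) ∈ S from ⟨hρ0, hρ.2, h3⟩)]
    · rw [indicator_of_notMem hρ, hA, indicator_of_notMem]
      exact fun h => hρ ⟨(div_lt_iff₀' ht).2 h.2.2, h.2.1⟩
  · have h3 : ∀ ρ, A (ρ, l) = 0 := fun ρ => indicator_of_notMem (fun h => hl (by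
      have h4 := abs_lt.1 (show |l - r| < t * ρ from h.2.2)
      have h5 : t * ρ < t := by nlinarith [show ρ < 1 from h.2.1]
      exact ⟨by linarith, by linarith⟩)) _
    rw [indicator_of_notMem hl]
    simp [h3]

theorem measurable_indicator_of_continuousOn {s : Set ℝ} {f : ℝ → ℝ} (hf : ContinuousOn f s)
    (hs : MeasurableSet s) : Measurable (s.indicator f) := by
  classical
  rw [← piecewise_eq_indicator]
  exact hf.measurable_piecewise continuousOn_const hs

theorem waveMean_of_even {n : ℕ} (hn : 2 ≤ n) (he : Even n) {x : EuclideanSpace ℝ (Fin n)}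
    {t : ℝ} (ht : 0 < t) (htx : t < ‖x‖) {ψ : ℝ → ℝ} (hψ : Measurable ψ) :
    waveMean n (fun y => ψ ‖y‖) x t = ∫ l in Ioo (‖x‖ - t) (‖x‖ + t),
      2 / sphereArea (n + 1) * ballDensity n ‖x‖ t l * ψ l := by
  have hr : 0 < ‖x‖ := ht.trans htx
  have hw : Measurable fun ξ : EuclideanSpace ℝ (Fin n) =>
    ENNReal.ofReal (1 / Real.sqrt (1 - ‖ξ‖ ^ 2)) := by fun_prop
  -- The weight 1/√(1-|ξ|²) is absorbed into the measure. The density is cut off outside the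
  -- interval, where neither its measurability nor its sign is available.
  have h := integral_comp_of_lintegral_density (μ := (volume.restrict
    (Metric.closedBall (0 : EuclideanSpace ℝ (Fin n)) 1)).withDensity
      (fun ξ => ENNReal.ofReal (1 / Real.sqrt (1 - ‖ξ‖ ^ 2)))) (X := fun ξ => ‖x + t • ξ‖)
    (by fun_prop) (s := Ioo (‖x‖ - t) (‖x‖ + t)) measurableSet_Ioo
    (D := indicator (Ioo (‖x‖ - t) (‖x‖ + t)) (ballDensity n ‖x‖ t))
    (measurable_indicator_of_continuousOn (continuousOn_ballDensity hr ht htx) measurableSet_Ioo)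
    (fun l hl => by rw [indicator_of_mem hl]; exact ballDensity_nonneg hn hr ht htx hl)
    (fun f hf => by
      rw [lintegral_withDensity_eq_lintegral_mul _ hw (by fun_prop)]
      refine (lintegral_ball_norm_add hn he ht htx f hf).trans ?_
      refine setLIntegral_congr_fun measurableSet_Ioo fun l hl => ?_
      simp only [indicator_of_mem hl]) hψ
  simp only [ENNReal.ofReal] at h hw
  rw [integral_withDensity_eq_integral_smul (by fun_prop)] at h
  rw [waveMean, if_pos he]
  have h2 : ∫ ξ in Metric.closedBall (0 : EuclideanSpace ℝ (Fin n)) 1,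
      ψ ‖x + t • ξ‖ / Real.sqrt (1 - ‖ξ‖ ^ 2) = ∫ l in Ioo (‖x‖ - t) (‖x‖ + t),
        (Ioo (‖x‖ - t) (‖x‖ + t)).indicator (ballDensity n ‖x‖ t) l * ψ l := by
    rw [← h]
    refine integral_congr_ae (Filter.Eventually.of_forall fun ξ => ?_)
    simp only [NNReal.smul_def, smul_eq_mul]
    rw [Real.coe_toNNReal _ (by positivity)]
    ring
  rw [h2, ← integral_const_mul]
  refine setIntegral_congr_fun measurableSet_Ioo fun l hl => ?_
  simp only [indicator_of_mem hl]
  ring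

end HartreeWave

/-! ### The means as cone integrals, with exponent q -/

namespace HartreeWave

open scoped ContDiff

theorem coneRatio_mul {r t l : ℝ} (hr : 0 < r) (hl : 0 < l) :
    t ^ 2 - (l - r) ^ 2 = 4 * r * l * coneRatio r t l := by
  unfold coneRatio
  field_simp

/-- The spherical mean of a radial function in odd dimensions, as an integral over the base of the
backward cone. -/
theorem pow_mul_waveMean_of_odd (k : ℕ) (hk : 2 ≤ 2 * (k + 1) + 1)
    (x : EuclideanSpace ℝ (Fin (2 * (k + 1) + 1))) {t : ℝ} (ht : t ∈ Ioo 0 (‖x‖ / 2)) {ψ : ℝ → ℝ}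
    (hψ : Measurable ψ) :
    t ^ (2 * (k + 1) - 1) * waveMean (2 * (k + 1) + 1) (fun y => ψ ‖y‖) x t =
      ∫ l in (‖x‖ - t)..(‖x‖ + t), ((l / ‖x‖) ^ ((k : ℝ) + 1) * (4 * ‖x‖ * l) ^ k * ψ l) *
        (coneRatio ‖x‖ t l ^ k * (sphereArea (2 * (k + 1)) / sphereArea (2 * (k + 1) + 1) *
          2 ^ (3 - ((2 * (k + 1) + 1 : ℕ) : ℝ)) * 4 ^ k * (1 - coneRatio ‖x‖ t l) ^ k)) := by
  have hodd : ¬ Even (2 * (k + 1) + 1) := by simp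
  obtain ⟨ht0, ht1⟩ := ht
  have hr : 0 < ‖x‖ := by linarith
  have hω := sphereArea_pos (k := 2 * (k + 1) + 1) (by omega)
  rw [waveMean_of_not_even hk hodd ht0 (by linarith) hψ, ← integral_const_mul,
    intervalIntegral.integral_of_le (by linarith), integral_Ioc_eq_integral_Ioo]
  refine setIntegral_congr_fun measurableSet_Ioo fun l hl => ?_
  have hl0 : 0 < l := by linarith [hl.1]
  have hexp : (((2 * (k + 1) + 1 : ℕ) : ℝ) - 3) / 2 = (k : ℕ) := by push_cast; ring
  have hexp' : (k : ℝ) + 1 = ((k + 1 : ℕ) : ℝ) := by push_cast; ring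
  -- Both brackets of the density are thus 4rl times a function of the ratio, which is why the
  -- kernel depends on r, t, l through z up to powers of r and l.
  have hsum : (l + ‖x‖) ^ 2 - t ^ 2 = 4 * ‖x‖ * l * (1 - coneRatio ‖x‖ t l) := by
    have := coneRatio_mul (t := t) hr hl0
    linear_combination -this
  rw [sphereDensity_eq hk hr ht0 ⟨by rw [abs_sub_comm, abs_of_pos (by linarith)]; exact hl.1.le,
      by linarith [hl.2]⟩, hexp, Real.rpow_natCast, hexp', Real.rpow_natCast, hsum,
    coneRatio_mul hr hl0, add_tsub_cancel_right, show 2 * (k + 1) - 1 = 2 * k + 1 by omega,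
    show 2 * (k + 1) + 1 - 2 = 2 * k + 1 by omega]
  generalize (2 : ℝ) ^ (3 - ((2 * (k + 1) + 1 : ℕ) : ℝ)) = c
  generalize coneRatio ‖x‖ t l = z
  generalize 1 - z = z'
  simp only [mul_pow, div_pow, pow_succ, pow_mul']
  field_simp

/-- The weighted mean of a radial function in even dimensions, as an integral over the base of the
backward cone. -/
theorem pow_mul_waveMean_of_even (k : ℕ) (hk : 2 ≤ 2 * (k + 1))
    (x : EuclideanSpace ℝ (Fin (2 * (k + 1)))) {t : ℝ} (ht : t ∈ Ioo 0 (‖x‖ / 2)) {ψ : ℝ → ℝ}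
    (hψ : Measurable ψ) :
    t ^ (2 * (k + 1) - 1) * waveMean (2 * (k + 1)) (fun y => ψ ‖y‖) x t =
      ∫ l in (‖x‖ - t)..(‖x‖ + t), ((l / ‖x‖) ^ ((k : ℝ) + 1 / 2) * (4 * ‖x‖ * l) ^ k * ψ l) *
        (coneRatio ‖x‖ t l ^ k * (2 / sphereArea (2 * (k + 1) + 1) * sphereArea (2 * k + 1) *
          2 ^ (3 - ((2 * (k + 1) : ℕ) : ℝ)) * 4 ^ ((k : ℝ) - 1 / 2) *
            sinIntegral k ((k : ℝ) - 1 / 2) (coneRatio ‖x‖ t l))) := by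
  have heven : Even (2 * (k + 1)) := even_two_mul _
  obtain ⟨ht0, ht1⟩ := ht
  have hr : 0 < ‖x‖ := by linarith
  have hω := sphereArea_pos (k := 2 * (k + 1) + 1) (by omega)
  rw [waveMean_of_even hk heven ht0 (by linarith) hψ, ← integral_const_mul,
    intervalIntegral.integral_of_le (by linarith), integral_Ioc_eq_integral_Ioo]
  refine setIntegral_congr_fun measurableSet_Ioo fun l hl => ?_
  have hl0 : 0 < l := by linarith [hl.1]
  have hexp : (((2 * (k + 1) : ℕ) : ℝ) - 3) / 2 = (k : ℝ) - 1 / 2 := by push_cast; ring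
  have h1 : (4 * ‖x‖ * l) ^ ((k : ℝ) - 1 / 2) =
      4 ^ ((k : ℝ) - 1 / 2) * ‖x‖ ^ ((k : ℝ) - 1 / 2) * l ^ ((k : ℝ) - 1 / 2) := by
    rw [Real.mul_rpow (by positivity) hl0.le, Real.mul_rpow (by norm_num) hr.le]
  have h2 : l ^ ((k : ℝ) + 1 / 2) = l * l ^ ((k : ℝ) - 1 / 2) := by
    rw [← Real.rpow_one_add' hl0.le (by
      have : (0 : ℝ) ≤ k := Nat.cast_nonneg k
      intro h
      linarith)]
    congr 1
    ring
  have h3 : ‖x‖ ^ ((k : ℝ) - 1 / 2) * ‖x‖ ^ ((k : ℝ) + 1 / 2) = ‖x‖ ^ (2 * k) := by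
    rw [← Real.rpow_add hr, ← Real.rpow_natCast]
    congr 1
    push_cast
    ring
  rw [ballDensity, hexp, Real.div_rpow hl0.le hr.le, h1, h2, show 2 * (k + 1) / 2 - 1 = k by omega,
    show 2 * (k + 1) - 1 = 2 * k + 1 by omega, show 2 * (k + 1) - 2 = 2 * k by omega,
    coneRatio_mul hr hl0, mul_pow _ (coneRatio ‖x‖ t l), ← h3]
  have h4 : 0 < ‖x‖ ^ ((k : ℝ) - 1 / 2) := by positivity
  have h5 : 0 < ‖x‖ ^ ((k : ℝ) + 1 / 2) := by positivity
  generalize (2 : ℝ) ^ (3 - ((2 * (k + 1) : ℕ) : ℝ)) = c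
  generalize ‖x‖ ^ ((k : ℝ) - 1 / 2) = P1 at *
  generalize ‖x‖ ^ ((k : ℝ) + 1 / 2) = P2 at *
  generalize l ^ ((k : ℝ) - 1 / 2) = P3 at *
  generalize (4 : ℝ) ^ ((k : ℝ) - 1 / 2) = P4 at *
  generalize sinIntegral k ((k : ℝ) - 1 / 2) (coneRatio ‖x‖ t l) = P5 at *
  generalize (4 * ‖x‖ * l) ^ k = P6 at *
  rw [pow_succ]
  field_simp

/-- The means of radial functions as integrals over the base of the backward cone. -/
theorem exists_waveMean_rep {n : ℕ} (hn : 2 ≤ n) : ∃ (q : ℝ) (κ : ℝ → ℝ),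
    ((n / 2 : ℕ) : ℝ) - 1 / 2 ≤ q ∧ q ≤ (n / 2 : ℕ) ∧ ContDiffOn ℝ ∞ κ (Iio 1) ∧
    ∀ (x : EuclideanSpace ℝ (Fin n)) (ψ : ℝ → ℝ), Measurable ψ → ∀ t ∈ Ioo 0 (‖x‖ / 2),
      t ^ (2 * (n / 2) - 1) * waveMean n (fun y => ψ ‖y‖) x t =
        ∫ l in (‖x‖ - t)..(‖x‖ + t), ((l / ‖x‖) ^ q * (4 * ‖x‖ * l) ^ (n / 2 - 1) * ψ l) *
          (coneRatio ‖x‖ t l ^ (n / 2 - 1) * κ (coneRatio ‖x‖ t l)) := by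
  rcases Nat.even_or_odd' n with ⟨m, rfl | rfl⟩
  · obtain ⟨k, rfl⟩ : ∃ k, m = k + 1 := ⟨m - 1, by omega⟩
    rw [show 2 * (k + 1) / 2 = k + 1 by omega, add_tsub_cancel_right]
    -- Unification finds q = k + 1/2 = m - 1/2 here; in odd dimension it finds q = k + 1 = m.
    refine ⟨_, fun z => (2 / sphereArea (2 * (k + 1) + 1) * sphereArea (2 * k + 1) *
      2 ^ (3 - ((2 * (k + 1) : ℕ) : ℝ)) * 4 ^ ((k : ℝ) - 1 / 2) *
      sinIntegral k ((k : ℝ) - 1 / 2) z), ?_, ?_, ?_, fun x ψ hψ t ht => pow_mul_waveMean_of_even k hn x ht hψ⟩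
    · push_cast; linarith
    · push_cast; linarith
    · exact contDiffOn_const.mul (contDiffOn_sinIntegral k _)
  · obtain ⟨k, rfl⟩ : ∃ k, m = k + 1 := ⟨m - 1, by omega⟩
    rw [show (2 * (k + 1) + 1) / 2 = k + 1 by omega, add_tsub_cancel_right]
    refine ⟨_, fun z => (sphereArea (2 * (k + 1)) / sphereArea (2 * (k + 1) + 1) *
      2 ^ (3 - ((2 * (k + 1) + 1 : ℕ) : ℝ)) * 4 ^ k * (1 - z) ^ k), ?_, ?_, ?_, fun x ψ hψ t ht => pow_mul_waveMean_of_odd k hn x ht hψ⟩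
    · push_cast; linarith
    · push_cast; linarith
    · exact contDiffOn_const.mul ((contDiffOn_const.sub contDiffOn_id).pow k)

end HartreeWave

/-! ### Normalization: W(1|x,t) = t and K(0) = 1/2 -/

namespace HartreeWave

open scoped ENNReal Topology

theorem lintegral_sin_pow_half (k : ℕ) :
    ∫⁻ θ in Ioo 0 Real.pi, ENNReal.ofReal (Real.sin θ ^ k) =
      2 * ∫⁻ θ in Ioo 0 (Real.pi / 2), ENNReal.ofReal (Real.sin θ ^ k) := by
  have hpi := Real.pi_pos
  have h1 : Ioo 0 Real.pi = Ioc 0 (Real.pi / 2) ∪ Ioo (Real.pi / 2) Real.pi :=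
    (Ioc_union_Ioo_eq_Ioo (by linarith) (by linarith)).symm
  have h2 : Disjoint (Ioc 0 (Real.pi / 2)) (Ioo (Real.pi / 2) Real.pi) :=
    disjoint_left.2 fun θ h h' => absurd h.2 (not_le.2 h'.1)
  have h3 : ∫⁻ θ in Ioo (Real.pi / 2) Real.pi, ENNReal.ofReal (Real.sin θ ^ k) =
      ∫⁻ θ in Ioo 0 (Real.pi / 2), ENNReal.ofReal (Real.sin θ ^ k) := by
    rw [← lintegral_indicator measurableSet_Ioo, ← lintegral_indicator measurableSet_Ioo,
      ← lintegral_sub_left_eq_self _ Real.pi]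
    refine lintegral_congr fun θ => ?_
    simp only [indicator, mem_Ioo, Real.sin_pi_sub]
    refine if_congr ⟨fun h => ⟨by linarith [h.2], by linarith [h.1]⟩,
      fun h => ⟨by linarith [h.2], by linarith [h.1]⟩⟩ rfl rfl
  rw [h1, lintegral_union measurableSet_Ioo h2, h3, setLIntegral_congr Ioo_ae_eq_Ioc.symm, two_mul]

theorem lintegral_pow_div_sqrt (k : ℕ) :
    ∫⁻ ρ in Ioo (0 : ℝ) 1, ENNReal.ofReal (ρ ^ k / Real.sqrt (1 - ρ ^ 2)) =
      ∫⁻ θ in Ioo 0 (Real.pi / 2), ENNReal.ofReal (Real.sin θ ^ k) := by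
  have hpi := Real.pi_pos
  have himg : Real.sin '' Ioo 0 (Real.pi / 2) = Ioo 0 1 := by
    ext ρ
    constructor
    · rintro ⟨θ, hθ, rfl⟩
      refine ⟨Real.sin_pos_of_pos_of_lt_pi hθ.1 (by linarith [hθ.2]), ?_⟩
      rw [← Real.sin_pi_div_two]
      exact Real.sin_lt_sin_of_lt_of_le_pi_div_two (by linarith [hθ.1]) le_rfl hθ.2
    · rintro ⟨h0, h1⟩
      exact ⟨Real.arcsin ρ, ⟨Real.arcsin_pos.2 h0, Real.arcsin_lt_pi_div_two.2 h1⟩,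
        Real.sin_arcsin (by linarith) h1.le⟩
  rw [← himg, lintegral_image_eq_lintegral_abs_deriv_mul measurableSet_Ioo
    (fun θ _ => (Real.hasDerivAt_sin θ).hasDerivWithinAt)
    (Real.injOn_sin.mono fun θ (hθ : θ ∈ Ioo 0 (Real.pi / 2)) =>
      (⟨by linarith [hθ.1], hθ.2.le⟩ : θ ∈ Icc (-(Real.pi / 2)) (Real.pi / 2)))]
  refine setLIntegral_congr_fun measurableSet_Ioo fun θ hθ => ?_
  have hc := Real.cos_pos_of_mem_Ioo ⟨by linarith [hθ.1], hθ.2⟩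
  rw [← ENNReal.ofReal_mul (abs_nonneg _), abs_of_pos hc, ← Real.cos_sq', Real.sqrt_sq hc.le]
  congr 1
  field_simp

/-- Geometrically, the weighted ball is the projection of a hemisphere of the unit sphere in one
dimension more. Analytically, ρ = sin θ turns the radial integral into half of the one in
`sphereArea_succ`. -/
theorem lintegral_ball_one_div_sqrt {n : ℕ} (hn : 2 ≤ n) :
    ∫⁻ ξ in Metric.closedBall (0 : EuclideanSpace ℝ (Fin n)) 1,
      ENNReal.ofReal (1 / Real.sqrt (1 - ‖ξ‖ ^ 2)) = ENNReal.ofReal (sphereArea (n + 1) / 2) := by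
  have hm : Measurable ((Iic (1 : ℝ)).indicator fun ρ =>
      ENNReal.ofReal (1 / Real.sqrt (1 - ρ ^ 2))) := Measurable.indicator (by fun_prop) measurableSet_Iic
  have h1 := lintegral_radial (k := n) (by omega) _ hm
  have h2 : ∫⁻ ξ in Metric.closedBall (0 : EuclideanSpace ℝ (Fin n)) 1,
      ENNReal.ofReal (1 / Real.sqrt (1 - ‖ξ‖ ^ 2)) = ∫⁻ ξ : EuclideanSpace ℝ (Fin n),
        (Iic (1 : ℝ)).indicator (fun ρ => ENNReal.ofReal (1 / Real.sqrt (1 - ρ ^ 2))) ‖ξ‖ := by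
    rw [← lintegral_indicator Metric.isClosed_closedBall.measurableSet]
    refine lintegral_congr fun ξ => ?_
    simp [indicator]
  have h3 : ∫⁻ ρ in Ioi (0 : ℝ), ENNReal.ofReal (ρ ^ (n - 1)) *
      (Iic (1 : ℝ)).indicator (fun ρ => ENNReal.ofReal (1 / Real.sqrt (1 - ρ ^ 2))) ρ =
      ∫⁻ ρ in Ioo (0 : ℝ) 1, ENNReal.ofReal (ρ ^ (n - 1) / Real.sqrt (1 - ρ ^ 2)) := by
    rw [setLIntegral_congr Ioo_ae_eq_Ioc, ← lintegral_indicator measurableSet_Ioi,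
      ← lintegral_indicator measurableSet_Ioc]
    refine lintegral_congr fun ρ => ?_
    by_cases h0 : 0 < ρ
    · by_cases h1 : ρ ≤ 1
      · simp only [indicator, mem_Ioi, mem_Iic, mem_Ioc, h0, h1, and_self, if_true]
        rw [← ENNReal.ofReal_mul (by positivity), mul_one_div]
      · simp [indicator, h1]
    · simp [indicator, h0]
  have h4 := sphereArea_succ (k := n) (by omega)
  rw [lintegral_sin_pow_half] at h4
  rw [h2, h1, h3, lintegral_pow_div_sqrt, ENNReal.ofReal_div_of_pos two_pos, h4, mul_left_comm,
    ENNReal.ofReal_ofNat, mul_comm (2 : ℝ≥0∞), ENNReal.mul_div_cancel_right two_ne_zero ENNReal.ofNat_ne_top]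

theorem waveMean_one {n : ℕ} (hn : 2 ≤ n) (x : EuclideanSpace ℝ (Fin n)) (t : ℝ) :
    waveMean n (fun _ => 1) x t = 1 := by
  rw [waveMean]
  split_ifs with he
  · have hω := sphereArea_pos (k := n + 1) (by omega)
    rw [integral_eq_lintegral_of_nonneg_ae (Filter.Eventually.of_forall fun ξ => by
      simp only [Pi.zero_apply]; positivity)
      (Measurable.aestronglyMeasurable (by fun_prop)), lintegral_ball_one_div_sqrt hn,
      ENNReal.toReal_ofReal (by positivity)]
    field_simp
  · have hω := sphereArea_pos (k := n) (by omega)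
    rw [integral_const, measureReal_def, toSphere_univ (by omega), ENNReal.toReal_ofReal hω.le,
      smul_eq_mul, mul_one, one_div, inv_mul_cancel₀ hω.ne']

/-- Each application lowers the exponent by two and releases an odd factor; the product is the
double factorial by which `waveOp` divides. -/
theorem invTimeDeriv_iterate_pow (k : ℕ) : EqOn (invTimeDeriv^[k] fun τ : ℝ => τ ^ (2 * k + 1))
    (fun τ => ((2 * k + 1).doubleFactorial : ℝ) * τ) (Ioi 0) := by
  induction k with
  | zero => intro τ _; simp
  | succ k ih =>
    intro t ht
    rw [Function.iterate_succ, Function.comp]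
    have h : EqOn (invTimeDeriv fun τ : ℝ => τ ^ (2 * (k + 1) + 1))
        (fun τ => (2 * (k : ℝ) + 3) * τ ^ (2 * k + 1)) (Ioi 0) := by
      intro τ hτ
      have hτ0 : τ ≠ 0 := ne_of_gt hτ
      simp only [invTimeDeriv, deriv_pow_field, show 2 * (k + 1) + 1 - 1 = 2 * k + 1 + 1 by omega,
        pow_succ τ (2 * k + 1)]
      push_cast
      field_simp
      ring
    rw [invTimeDeriv_iterate_congr isOpen_Ioi k h ht, invTimeDeriv_iterate_const_mul]
    simp only
    rw [ih ht, show 2 * (k + 1) + 1 = 2 * k + 1 + 2 by ring, Nat.doubleFactorial_add_two]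
    push_cast
    ring

theorem waveOp_one {n : ℕ} (hn : 2 ≤ n) (x : EuclideanSpace ℝ (Fin n)) {t : ℝ} (ht : 0 < t) :
    waveOp n (fun _ => 1) x t = t := by
  obtain ⟨k, hk⟩ : ∃ k, n / 2 = k + 1 := ⟨n / 2 - 1, by omega⟩
  have h := invTimeDeriv_iterate_pow k (mem_Ioi.2 ht)
  have hd : ((2 * k + 1).doubleFactorial : ℝ) ≠ 0 := by
    exact_mod_cast (Nat.doubleFactorial_pos _).ne'
  simp only [waveOp, waveMean_one hn, mul_one, hk, add_tsub_cancel_right,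
    show 2 * (k + 1) - 1 = 2 * k + 1 by omega]
  rw [h]
  field_simp

/-- For t < |x| the ball of radius t about x misses the origin, so the uncontrolled value of a
radial profile at 0 is harmless. -/
theorem waveMean_congr {n : ℕ} {x : EuclideanSpace ℝ (Fin n)} {t : ℝ} (ht : 0 < t)
    (htx : t < ‖x‖) {φ₁ φ₂ : EuclideanSpace ℝ (Fin n) → ℝ} (h : ∀ y, y ≠ 0 → φ₁ y = φ₂ y) :
    waveMean n φ₁ x t = waveMean n φ₂ x t := by
  have hne : ∀ ξ : EuclideanSpace ℝ (Fin n), ‖ξ‖ ≤ 1 → x + t • ξ ≠ 0 := by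
    intro ξ hξ h0
    have h1 : ‖x‖ = t * ‖ξ‖ := by
      rw [eq_neg_of_add_eq_zero_left h0, norm_neg, norm_smul, Real.norm_of_nonneg ht.le]
    nlinarith
  rw [waveMean, waveMean]
  split_ifs with he
  · congr 1
    refine setIntegral_congr_fun Metric.isClosed_closedBall.measurableSet fun ξ hξ => ?_
    rw [h _ (hne ξ (by simpa using hξ))]
  · congr 1
    refine integral_congr_ae (Filter.Eventually.of_forall fun ω => ?_)
    exact h _ (hne _ (norm_eq_of_mem_sphere ω).le)

theorem continuousOn_coneKernel {K : ℝ → ℝ} (hK : ContinuousOn K (Iio 1)) (q : ℝ) {r t : ℝ}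
    (hr : 0 < r) (ht : t ∈ Icc 0 (r / 2)) :
    ContinuousOn (fun l => (l / r) ^ q * K (coneRatio r t l)) (Icc (r - t) (r + t)) := by
  have h0 : ∀ l ∈ Icc (r - t) (r + t), 0 < l := fun l hl => by linarith [hl.1, ht.2]
  refine ContinuousOn.mul (ContinuousOn.rpow_const (by fun_prop) fun l hl => Or.inl ?_)
    (hK.comp ((continuousOn_coneRatio r t hr).mono h0) fun l hl =>
      coneRatio_lt_one hr ht (by linarith [hl.1, ht.2]))
  have := h0 l hl
  positivity

/-- A kernel reproducing `t` has the value `1 / 2` at the boundary of the cone. -/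
theorem coneKernel_zero {K : ℝ → ℝ} (hK : ContinuousOn K (Iio 1)) (q : ℝ)
    (h : ∀ t ∈ Ioo (0 : ℝ) (1 / 2),
      ∫ l in (1 - t)..(1 + t), (l / 1) ^ q * K (coneRatio 1 t l) = t) : K 0 = 1 / 2 := by
  have hcont : ContinuousAt (fun p : ℝ × ℝ => (p.1 / 1) ^ q * K p.2) (1, 0) := by
    refine ContinuousAt.mul (ContinuousAt.rpow_const (by fun_prop) (by simp)) ?_
    exact (hK.continuousAt (Iio_mem_nhds one_pos)).comp (f := Prod.snd) (x := ((1 : ℝ), (0 : ℝ)))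
      continuousAt_snd
  refine eq_of_forall_dist_le fun ε hε => ?_
  obtain ⟨d, hd, hball⟩ := Metric.continuousAt_iff.1 hcont ε hε
  -- This t puts both l - 1 and the ratio within d of their limits over the whole base, so the
  -- integrand is within ε of K(0) on an interval of length 2t.
  set t := min (d / 2) (1 / 4) with ht
  have ht0 : 0 < t := lt_min (by linarith) (by norm_num)
  have ht1 : t ≤ 1 / 4 := min_le_right _ _
  have ht2 : t < d := (min_le_left _ _).trans_lt (by linarith)
  have htI : t ∈ Icc (0 : ℝ) (1 / 2) := ⟨ht0.le, by linarith⟩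
  have hle : 1 - t ≤ 1 + t := by linarith
  have hb : ∀ l ∈ uIoc (1 - t) (1 + t), ‖(l / 1) ^ q * K (coneRatio 1 t l) - K 0‖ ≤ ε := by
    intro l hl
    rw [uIoc_of_le hle] at hl
    have hl0 : 0 < l := by linarith [hl.1]
    have hz0 : 0 ≤ coneRatio 1 t l :=
      coneRatio_nonneg one_pos hl0 (abs_le.2 ⟨by linarith [hl.1], by linarith [hl.2]⟩)
    have hz1 : coneRatio 1 t l < d := by
      rw [coneRatio, div_lt_iff₀ (by positivity)]
      nlinarith [sq_nonneg (l - 1), hl.1]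
    have hl1 : |l - 1| < d := abs_lt.2 ⟨by linarith [hl.1], by linarith [hl.2]⟩
    have := hball (x := (l, coneRatio 1 t l)) (by
      rw [Prod.dist_eq, max_lt_iff, Real.dist_eq, Real.dist_eq]
      exact ⟨hl1, by simpa [abs_of_nonneg hz0] using hz1⟩)
    simpa [Real.dist_eq] using this.le
  have hi : IntervalIntegrable (fun l => (l / 1) ^ q * K (coneRatio 1 t l)) volume (1 - t) (1 + t) := by
    refine ContinuousOn.intervalIntegrable ?_
    rw [uIcc_of_le hle]
    exact continuousOn_coneKernel hK q one_pos htI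
  have h1 := intervalIntegral.norm_integral_le_of_norm_le_const hb
  rw [intervalIntegral.integral_sub hi intervalIntegrable_const, h t ⟨ht0, by linarith⟩,
    intervalIntegral.integral_const, smul_eq_mul, Real.norm_eq_abs,
    show t - (1 + t - (1 - t)) * K 0 = (-(2 * t)) * (K 0 - 1 / 2) by ring, abs_mul, abs_neg,
    abs_of_pos (by positivity : 0 < 2 * t), abs_of_pos (by linarith : 0 < 1 + t - (1 - t))] at h1
  rw [Real.dist_eq]
  have h2 : (2 * t) * |K 0 - 1 / 2| ≤ (2 * t) * ε := by linarith
  exact le_of_mul_le_mul_left h2 (by positivity)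

/-- The solution operator applied to a radial function, as an integral over the base of the
backward cone. -/
theorem exists_waveOp_rep {n : ℕ} (hn : 2 ≤ n) : ∃ (q : ℝ) (K : ℝ → ℝ),
    ((n / 2 : ℕ) : ℝ) - 1 / 2 ≤ q ∧ q ≤ (n / 2 : ℕ) ∧ ContinuousOn K (Iio 1) ∧ K 0 = 1 / 2 ∧
    ∀ (x : EuclideanSpace ℝ (Fin n)) (φ : EuclideanSpace ℝ (Fin n) → ℝ) (ψ : ℝ → ℝ),
      ContinuousOn ψ (Ioi 0) → (∀ y, y ≠ 0 → φ y = ψ ‖y‖) → ∀ t ∈ Ioo 0 (‖x‖ / 2),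
      waveOp n φ x t = ∫ l in (‖x‖ - t)..(‖x‖ + t),
        (l / ‖x‖) ^ q * K (coneRatio ‖x‖ t l) * ψ l := by
  obtain ⟨q, κ, hq1, hq2, hκ, hmean⟩ := exists_waveMean_rep hn
  obtain ⟨K₀, hK₀, hiter⟩ := exists_invTimeDeriv_iterate_integral_cone (n / 2 - 1) hκ
  -- The power of 2 is the quotient of (4rl)^{m-1}, from the means, by (2rl)^{m-1}, from the m-1
  -- derivatives.
  set c : ℝ := 1 / (Nat.doubleFactorial (2 * (n / 2) - 1) : ℝ) * 2 ^ (n / 2 - 1) with hc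
  have hrep : ∀ (x : EuclideanSpace ℝ (Fin n)) (φ : EuclideanSpace ℝ (Fin n) → ℝ) (ψ : ℝ → ℝ),
      ContinuousOn ψ (Ioi 0) → (∀ y, y ≠ 0 → φ y = ψ ‖y‖) → ∀ t ∈ Ioo 0 (‖x‖ / 2),
      waveOp n φ x t = ∫ l in (‖x‖ - t)..(‖x‖ + t),
        (l / ‖x‖) ^ q * (c * K₀ (coneRatio ‖x‖ t l)) * ψ l := by
    intro x φ ψ hψ hφ t ht
    have hr : 0 < ‖x‖ := by linarith [ht.1, ht.2]
    have hψm := measurable_indicator_of_continuousOn hψ measurableSet_Ioi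
    have hχ : ContinuousOn (fun l => (l / ‖x‖) ^ q * (4 * ‖x‖ * l) ^ (n / 2 - 1) *
        (Ioi (0 : ℝ)).indicator ψ l) (Ioi 0) := by
      refine ContinuousOn.mul (ContinuousOn.mul (ContinuousOn.rpow_const (by fun_prop)
        fun l (hl : 0 < l) => Or.inl (by positivity)) (by fun_prop)) ?_
      exact hψ.congr fun l hl => indicator_of_mem hl _
    have heq : EqOn (fun τ => τ ^ (2 * (n / 2) - 1) * waveMean n φ x τ)
        (fun τ => ∫ l in (‖x‖ - τ)..(‖x‖ + τ), ((l / ‖x‖) ^ q * (4 * ‖x‖ * l) ^ (n / 2 - 1) *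
          (Ioi (0 : ℝ)).indicator ψ l) * (coneRatio ‖x‖ τ l ^ (n / 2 - 1) *
            κ (coneRatio ‖x‖ τ l))) (Ioo 0 (‖x‖ / 2)) := by
      intro τ hτ
      simp only
      rw [← hmean x _ hψm τ hτ, waveMean_congr hτ.1 (by linarith [hτ.2])
        (φ₂ := fun y => (Ioi (0 : ℝ)).indicator ψ ‖y‖)]
      intro y hy
      rw [hφ y hy, indicator_of_mem (mem_Ioi.2 (norm_pos_iff.2 hy))]
    rw [waveOp, invTimeDeriv_iterate_congr isOpen_Ioo _ heq ht, hiter _ _ hr hχ t ht,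
      ← intervalIntegral.integral_const_mul]
    refine intervalIntegral.integral_congr fun l hl => ?_
    rw [uIcc_of_le (by linarith [ht.1])] at hl
    have hl0 : 0 < l := by linarith [hl.1, ht.2]
    simp only [indicator_of_mem (mem_Ioi.2 hl0)]
    rw [hc, show 4 * ‖x‖ * l = 2 * (2 * ‖x‖ * l) by ring, mul_pow 2 (2 * ‖x‖ * l)]
    field_simp
  have hKc : ContinuousOn (fun z => c * K₀ z) (Iio 1) := continuousOn_const.mul hK₀.continuousOn
  refine ⟨q, fun z => c * K₀ z, hq1, hq2, hKc, ?_, hrep⟩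
  -- The representation is tested on the constant 1 at a unit vector, where `waveOp_one` gives t.
  refine coneKernel_zero hKc q fun t ht => ?_
  have hx : ‖(EuclideanSpace.single (⟨0, by omega⟩ : Fin n) (1 : ℝ))‖ = 1 := by simp
  have h := hrep (EuclideanSpace.single ⟨0, by omega⟩ 1) (fun _ => 1) (fun _ => 1)
    continuousOn_const (fun _ _ => rfl) t (by rwa [hx])
  rw [hx, waveOp_one hn _ ht.1] at h
  simpa using h.symm

end HartreeWave

/-! ### The backward cone: kernel bounds, positivity, lower bound -/

namespace HartreeWave

open scoped Topology

/-- The backward cone of `(r, t)`. -/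
def backwardCone (r t : ℝ) : Set (ℝ × ℝ) := {p | 0 ≤ p.2 ∧ p.2 ≤ t ∧ |p.1 - r| ≤ t - p.2}

theorem mem_backwardCone_iff {r t : ℝ} {l s : ℝ} :
    (l, s) ∈ backwardCone r t ↔ s ∈ Icc 0 t ∧ l ∈ Icc (r - (t - s)) (r + (t - s)) := by
  simp only [backwardCone, mem_ofPred_eq, mem_Icc, abs_le, and_assoc]
  constructor
  · rintro ⟨h1, h2, h3, h4⟩
    exact ⟨h1, h2, by linarith, by linarith⟩
  · rintro ⟨h1, h2, h3, h4⟩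
    exact ⟨h1, h2, by linarith, by linarith⟩

theorem isCompact_backwardCone (r t : ℝ) : IsCompact (backwardCone r t) := by
  have hsub : backwardCone r t ⊆ Icc (r - t) (r + t) ×ˢ Icc 0 t := by
    rintro ⟨l, s⟩ h
    obtain ⟨h1, h2⟩ := mem_backwardCone_iff.1 h
    exact ⟨⟨by linarith [h1.1, h2.1], by linarith [h1.1, h2.2]⟩, h1⟩
  refine (isCompact_Icc.prod isCompact_Icc).of_isClosed_subset ?_ hsub
  have : backwardCone r t = {p : ℝ × ℝ | 0 ≤ p.2} ∩ ({p | p.2 ≤ t} ∩ {p | |p.1 - r| ≤ t - p.2}) := rfl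
  rw [this]
  exact (isClosed_le (by fun_prop) (by fun_prop)).inter
    ((isClosed_le (by fun_prop) (by fun_prop)).inter (isClosed_le (by fun_prop) (by fun_prop)))

theorem backwardCone_subset {r t l s : ℝ} (h : (l, s) ∈ backwardCone r t) :
    backwardCone l s ⊆ backwardCone r t := by
  rintro ⟨l', s'⟩ h'
  rw [mem_backwardCone_iff] at *
  obtain ⟨⟨h1, h2⟩, h3, h4⟩ := h
  obtain ⟨⟨h1', h2'⟩, h3', h4'⟩ := h'
  exact ⟨⟨h1', by linarith⟩, by linarith, by linarith⟩

theorem continuousOn_slice {r t s : ℝ} {H : ℝ × ℝ → ℝ} (hH : ContinuousOn H (backwardCone r t))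
    (hs : s ∈ Icc 0 t) :
    ContinuousOn (fun l => H (l, s)) (Icc (r - (t - s)) (r + (t - s))) :=
  hH.comp (by fun_prop) fun _ hl => mem_backwardCone_iff.2 ⟨hs, hl⟩

theorem intervalIntegrable_slice {r t s : ℝ} {H : ℝ × ℝ → ℝ}
    (hH : ContinuousOn H (backwardCone r t)) (hs : s ∈ Icc 0 t) :
    IntervalIntegrable (fun l => H (l, s)) volume (r - (t - s)) (r + (t - s)) := by
  refine ContinuousOn.intervalIntegrable ?_
  rw [uIcc_of_le (by linarith [hs.2])]
  exact continuousOn_slice hH hs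

/-- By Tietze, `H` extends continuously from the compact cone to the plane, where integrals with
continuous endpoints depend continuously on the parameter. -/
theorem continuousOn_integral_slice {r t : ℝ} {H : ℝ × ℝ → ℝ}
    (hH : ContinuousOn H (backwardCone r t)) :
    ContinuousOn (fun s => ∫ l in (r - (t - s))..(r + (t - s)), H (l, s)) (Icc 0 t) := by
  obtain ⟨G, hG⟩ := ContinuousMap.exists_restrict_eq (isCompact_backwardCone r t).isClosed
    ⟨_, hH.domRestrict⟩
  have hGH : ∀ p ∈ backwardCone r t, G p = H p := fun p hp =>
    congrArg (fun F : C(backwardCone r t, ℝ) => F ⟨p, hp⟩) hG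
  have hc : Continuous (Function.uncurry fun s l : ℝ => G (l, s)) := by
    unfold Function.uncurry
    fun_prop
  have h : Continuous fun s => (∫ l in (0 : ℝ)..(r + (t - s)), G (l, s)) -
      ∫ l in (0 : ℝ)..(r - (t - s)), G (l, s) :=
    (intervalIntegral.continuous_parametric_intervalIntegral_of_continuous hc (by fun_prop)).sub
      (intervalIntegral.continuous_parametric_intervalIntegral_of_continuous hc (by fun_prop))
  refine h.continuousOn.congr fun s hs => ?_
  have hi : ∀ a b, IntervalIntegrable (fun l => G (l, s)) volume a b := fun a b =>
    Continuous.intervalIntegrable (by fun_prop) a b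
  beta_reduce
  rw [intervalIntegral.integral_interval_sub_left (hi _ _) (hi _ _)]
  refine intervalIntegral.integral_congr fun l hl => ?_
  rw [uIcc_of_le (by linarith [hs.2])] at hl
  exact (hGH _ (mem_backwardCone_iff.2 ⟨hs, hl⟩)).symm

theorem continuousOn_coneKernel_prod {K : ℝ → ℝ} (hK : ContinuousOn K (Iio 1)) (q : ℝ) {r t : ℝ}
    (hr : 0 < r) (ht : t ≤ r / 2) :
    ContinuousOn (fun p : ℝ × ℝ => (p.1 / r) ^ q * K (coneRatio r (t - p.2) p.1))
      (backwardCone r t) := by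
  have h0 : ∀ p ∈ backwardCone r t, t - p.2 ∈ Icc 0 (r / 2) ∧ r / 2 ≤ p.1 := by
    rintro ⟨l, s⟩ h
    obtain ⟨h1, h2⟩ := mem_backwardCone_iff.1 h
    exact ⟨⟨by linarith [h1.2], by simp only; linarith [h1.1]⟩, by simp only; linarith [h1.1, h2.1]⟩
  refine ContinuousOn.mul (ContinuousOn.rpow_const (by fun_prop) fun p hp => Or.inl ?_)
    (hK.comp ?_ fun p hp => coneRatio_lt_one hr (h0 p hp).1 (h0 p hp).2)
  · have : 0 < p.1 := by linarith [(h0 p hp).2]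
    positivity
  · unfold coneRatio
    refine ContinuousOn.div (by fun_prop) (by fun_prop) fun p hp => ?_
    have : 0 < p.1 := by linarith [(h0 p hp).2]
    positivity

/-- In a sufficiently flat cone the kernel is bounded and bounded below. -/
theorem exists_coneKernel_bounds {K : ℝ → ℝ} (hK : ContinuousOn K (Iio 1)) (hK0 : K 0 = 1 / 2)
    {m : ℕ} (hm : 1 ≤ m) {q : ℝ} (hq1 : (m : ℝ) - 1 / 2 ≤ q) (hq2 : q ≤ m) :
    ∃ δ C : ℝ, 2 ≤ δ ∧ 0 ≤ C ∧ ∀ r t l : ℝ, 0 < r → 0 ≤ t → δ * t ≤ r - t → |l - r| ≤ t →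
      1 / 8 * (l / r) ^ m ≤ (l / r) ^ q * K (coneRatio r t l) ∧
      (l / r) ^ q * K (coneRatio r t l) ≤ C := by
  obtain ⟨d, hd, hball⟩ := Metric.continuousAt_iff.1 (hK.continuousAt (Iio_mem_nhds one_pos))
    (1 / 4) (by norm_num)
  have hm' : (1 : ℝ) ≤ m := by exact_mod_cast hm
  -- With 1/d ≤ δ, both t ≤ dl and t ≤ r hold, so the ratio is below d and K lies in (1/4, 3/4).
  -- Since l/r ≤ 2 and 0 ≤ m - q ≤ 1/2, passing from exponent q to m costs at most a factor 2: the
  -- lower constant is 1/4 · 1/2.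
  refine ⟨max 2 (1 / d), 2 ^ q, le_max_left _ _, by positivity, fun r t l hr ht hδ hl => ?_⟩
  set δ := max 2 (1 / d) with hδdef
  have hδ2 : 2 ≤ δ := le_max_left _ _
  have hδd : 1 ≤ δ * d := by
    have h : 1 / d ≤ δ := le_max_right _ _
    rwa [div_le_iff₀ hd] at h
  obtain ⟨hl1, hl2⟩ := abs_le.1 hl
  have ht3 : 3 * t ≤ r := by nlinarith
  have hl0 : 0 < l := by linarith
  have hz0 : 0 ≤ coneRatio r t l := coneRatio_nonneg hr hl0 hl
  have hz1 : coneRatio r t l < d := by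
    rw [coneRatio, div_lt_iff₀ (by positivity)]
    have h1 : δ * t ≤ l := by linarith
    have h2 : δ * t ≤ r := by linarith
    have h3 : t ≤ d * l := by
      have := mul_le_mul_of_nonneg_left h1 hd.le
      nlinarith
    have h4 : t * t ≤ d * l * r := mul_le_mul h3 (by linarith) ht (by positivity)
    have h5 : 0 < d * l * r := by positivity
    nlinarith [sq_nonneg (l - r)]
  have hKz := hball (x := coneRatio r t l) (by simpa [Real.dist_eq, abs_of_nonneg hz0] using hz1)
  rw [hK0, Real.dist_eq, abs_lt] at hKz
  set y := l / r with hy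
  have hy0 : 0 < y := by positivity
  have hy2 : y ≤ 2 := by rw [hy, div_le_iff₀ hr]; linarith
  have h6 : y ^ ((m : ℝ) - q) ≤ 2 := by
    calc y ^ ((m : ℝ) - q) ≤ 2 ^ ((m : ℝ) - q) := Real.rpow_le_rpow hy0.le hy2 (by linarith)
      _ ≤ 2 ^ (1 : ℝ) := Real.rpow_le_rpow_of_exponent_le (by norm_num) (by linarith)
      _ = 2 := Real.rpow_one 2
  have h7 : y ^ m = y ^ q * y ^ ((m : ℝ) - q) := by
    rw [← Real.rpow_add hy0, ← Real.rpow_natCast]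
    congr 1
    ring
  have h8 : 0 < y ^ q := by positivity
  constructor
  · rw [h7]
    nlinarith
  · calc y ^ q * K (coneRatio r t l) ≤ y ^ q * 1 := by
          refine mul_le_mul_of_nonneg_left (by linarith) h8.le
      _ = y ^ q := mul_one _
      _ ≤ 2 ^ q := Real.rpow_le_rpow hy0.le hy2 (by linarith)

section Cone

variable {K : ℝ → ℝ} {q δ C : ℝ} {m : ℕ} {r t ε : ℝ} {g₀ : ℝ → ℝ} {U Ψ : ℝ × ℝ → ℝ}

/-- Flatness passes to every point of the cone, as l - s ≥ r - t and s ≤ t. Hence the kernel bounds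
and the integral equation are usable throughout it. -/
theorem mem_backwardCone_flat (hδ2 : 2 ≤ δ) (ht : 0 ≤ t) (hr : 0 < r) (hrt : δ * t ≤ r - t)
    {l s : ℝ} (h : (l, s) ∈ backwardCone r t) :
    0 < l ∧ 0 ≤ s ∧ δ * s ≤ l - s ∧ 3 * s ≤ l ∧ Icc (l - s) (l + s) ⊆ Icc (r - t) (r + t) := by
  obtain ⟨⟨h1, h2⟩, h3, h4⟩ := mem_backwardCone_iff.1 h
  have h5 : δ * s ≤ δ * t := mul_le_mul_of_nonneg_left h2 (by linarith)
  have h6 : 2 * t ≤ δ * t := mul_le_mul_of_nonneg_right hδ2 ht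
  exact ⟨by linarith, h1, by linarith, by nlinarith,
    Icc_subset_Icc (by linarith) (by linarith)⟩

/-- Positivity in the backward cone for solutions of the integral equation. -/
theorem pos_of_cone_equation (hK : ContinuousOn K (Iio 1)) (hδ2 : 2 ≤ δ) (hC : 0 ≤ C)
    (hker : ∀ r t l : ℝ, 0 < r → 0 ≤ t → δ * t ≤ r - t → |l - r| ≤ t →
      1 / 8 * (l / r) ^ m ≤ (l / r) ^ q * K (coneRatio r t l) ∧
      (l / r) ^ q * K (coneRatio r t l) ≤ C)
    (hr : 0 < r) (ht : 0 ≤ t) (hrt : δ * t ≤ r - t) (hε : 0 < ε)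
    (hg : ContinuousOn g₀ (Icc (r - t) (r + t))) (hgpos : ∀ l ∈ Icc (r - t) (r + t), 0 < g₀ l)
    (hU : ContinuousOn U (backwardCone r t)) (hΨ : ContinuousOn Ψ (backwardCone r t))
    (hsign : ∀ p ∈ backwardCone r t, 0 ≤ U p → 0 ≤ Ψ p)
    (heq : ∀ l s, (l, s) ∈ backwardCone r t → 0 < s → U (l, s) =
      ε * (∫ l' in (l - s)..(l + s), (l' / l) ^ q * K (coneRatio l s l') * g₀ l') +
      ∫ σ in (0 : ℝ)..s, ∫ l' in (l - (s - σ))..(l + (s - σ)),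
        (l' / l) ^ q * K (coneRatio l (s - σ) l') * Ψ (l', σ)) :
    ∀ p ∈ backwardCone r t, 0 < p.2 → 0 < U p := by
  have hne : (Icc (r - t) (r + t)).Nonempty := nonempty_Icc.2 (by linarith)
  obtain ⟨l₀, hl₀, hmin⟩ := isCompact_Icc.exists_isMinOn hne hg
  set c := g₀ l₀ with hc
  have hc0 : 0 < c := hgpos _ hl₀
  obtain ⟨B, hB⟩ := (isCompact_backwardCone r t).exists_bound_of_continuousOn hΨ
  have hB0 : 0 ≤ B := (norm_nonneg _).trans (hB (r, t) (mem_backwardCone_iff.2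
    ⟨⟨ht, le_rfl⟩, by simp⟩))
  -- Within flat cones l'/l ≥ 1/2, so `b` is a uniform lower bound for the kernel.
  set b : ℝ := 1 / 8 * (1 / 2) ^ m with hb
  have hb0 : 0 < b := by positivity
  have hkb : ∀ l s, (l, s) ∈ backwardCone r t → ∀ l' s', 0 ≤ s' → s' ≤ s → |l' - l| ≤ s' →
      b ≤ (l' / l) ^ q * K (coneRatio l s' l') ∧ (l' / l) ^ q * K (coneRatio l s' l') ≤ C := by
    intro l s h l' s' hs0 hss hl'
    obtain ⟨h1, h2, h3, h4, -⟩ := mem_backwardCone_flat hδ2 ht hr hrt h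
    have h5 : δ * s' ≤ l - s' := by nlinarith
    obtain ⟨h6, h7⟩ := hker l s' l' h1 hs0 h5 hl'
    refine ⟨le_trans ?_ h6, h7⟩
    have h8 : 1 / 2 ≤ l' / l := by
      rw [div_le_div_iff₀ two_pos h1]
      linarith [(abs_le.1 hl').1]
    exact mul_le_mul_of_nonneg_left (pow_le_pow_left₀ (by norm_num) h8 m) (by norm_num)
  have hfree : ∀ l s, (l, s) ∈ backwardCone r t → 0 < s → 2 * (ε * b * c) * s ≤
      ε * ∫ l' in (l - s)..(l + s), (l' / l) ^ q * K (coneRatio l s l') * g₀ l' := by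
    intro l s h hs
    obtain ⟨h1, h2, h3, h4, hsub⟩ := mem_backwardCone_flat hδ2 ht hr hrt h
    have hle : l - s ≤ l + s := by linarith
    have hi : IntervalIntegrable (fun l' => (l' / l) ^ q * K (coneRatio l s l') * g₀ l') volume
        (l - s) (l + s) := by
      refine ContinuousOn.intervalIntegrable ?_
      rw [uIcc_of_le hle]
      exact (continuousOn_coneKernel hK q h1 ⟨h2, by linarith⟩).mul (hg.mono hsub)
    have h5 := intervalIntegral.integral_mono_on hle (intervalIntegrable_const (c := b * c)) hi
      fun l' hl' => mul_le_mul (hkb l s h l' s h2 le_rfl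
        (abs_le.2 ⟨by linarith [hl'.1], by linarith [hl'.2]⟩)).1 (hmin (hsub hl')) hc0.le
        (hb0.le.trans (hkb l s h l' s h2 le_rfl
        (abs_le.2 ⟨by linarith [hl'.1], by linarith [hl'.2]⟩)).1)
    rw [intervalIntegral.integral_const, smul_eq_mul] at h5
    calc 2 * (ε * b * c) * s = ε * ((l + s - (l - s)) * (b * c)) := by ring
      _ ≤ _ := mul_le_mul_of_nonneg_left h5 hε.le
  -- The Duhamel term is at most 2CBs², the free term at least 2εbcs. This keeps possible zeros away
  -- from s = 0, where positivity is not claimed.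
  have hsmall : ∀ l s, (l, s) ∈ backwardCone r t → 0 < s → s < ε * b * c / (C * B + 1) →
      0 < U (l, s) := by
    intro l s h hs hs1
    rw [heq l s h hs]
    have h1 := hfree l s h hs
    have h2 : ‖∫ σ in (0 : ℝ)..s, ∫ l' in (l - (s - σ))..(l + (s - σ)),
        (l' / l) ^ q * K (coneRatio l (s - σ) l') * Ψ (l', σ)‖ ≤ (C * B * (2 * s)) * |s - 0| := by
      refine intervalIntegral.norm_integral_le_of_norm_le_const fun σ hσ => ?_
      rw [uIoc_of_le hs.le] at hσ
      have hσ' : σ ∈ Icc 0 s := ⟨hσ.1.le, hσ.2⟩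
      have h3 : ‖∫ l' in (l - (s - σ))..(l + (s - σ)),
          (l' / l) ^ q * K (coneRatio l (s - σ) l') * Ψ (l', σ)‖ ≤
          C * B * |l + (s - σ) - (l - (s - σ))| := by
        refine intervalIntegral.norm_integral_le_of_norm_le_const fun l' hl' => ?_
        rw [uIoc_of_le (by linarith [hσ.2])] at hl'
        have h4 := hkb l s h l' (s - σ) (by linarith [hσ.2]) (by linarith [hσ.1])
          (abs_le.2 ⟨by linarith [hl'.1], by linarith [hl'.2]⟩)
        rw [norm_mul, Real.norm_of_nonneg (hb0.le.trans h4.1)]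
        exact mul_le_mul h4.2 (hB _ (backwardCone_subset h (mem_backwardCone_iff.2
          ⟨hσ', Ioc_subset_Icc_self hl'⟩))) (norm_nonneg _) hC
      refine h3.trans (mul_le_mul_of_nonneg_left ?_ (by positivity))
      rw [abs_of_nonneg (by linarith [hσ.2])]
      linarith [hσ.1]
    rw [sub_zero, abs_of_pos hs] at h2
    have h3 := (abs_le.1 h2).1
    rw [lt_div_iff₀ (by positivity)] at hs1
    nlinarith [mul_pos hs hs]
  set s₀ := ε * b * c / (C * B + 1) with hs₀
  have hs₀0 : 0 < s₀ := by positivity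
  by_contra hcon
  push Not at hcon
  obtain ⟨p, hp, hp2, hpU⟩ := hcon
  -- The constraint s₀ ≤ s makes the bad set compact, so it has a point of least time; U is positive
  -- at all earlier positive times.
  set Z := backwardCone r t ∩ ({p | s₀ ≤ p.2} ∩ {p | p ∈ backwardCone r t ∧ U p ≤ 0}) with hZ
  have hge : ∀ p ∈ backwardCone r t, 0 < p.2 → U p ≤ 0 → s₀ ≤ p.2 := by
    rintro ⟨l, s⟩ h hs hUp
    by_contra hlt
    exact absurd (hsmall l s h hs (not_le.1 hlt)) (not_lt.2 hUp)
  have hZc : IsCompact Z := by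
    refine (isCompact_backwardCone r t).inter_right ?_
    refine (isClosed_le continuous_const continuous_snd).inter ?_
    exact hU.preimage_isClosed_of_isClosed (isCompact_backwardCone r t).isClosed isClosed_Iic
  obtain ⟨⟨l₁, s₁⟩, ⟨h1, h2, -, h3⟩, hmin₁⟩ := hZc.exists_isMinOn
    ⟨p, hp, hge p hp hp2 hpU, hp, hpU⟩ continuous_snd.continuousOn
  have hs₁ : 0 < s₁ := hs₀0.trans_le h2
  have hbefore : ∀ p ∈ backwardCone r t, 0 < p.2 → p.2 < s₁ → 0 < U p := by
    intro p hp hp0 hps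
    by_contra hU0
    have hU0' := not_lt.1 hU0
    have : s₁ ≤ p.2 := hmin₁ (show p ∈ Z from ⟨hp, hge p hp hp0 hU0', hp, hU0'⟩)
    linarith
  have hD : 0 ≤ ∫ σ in (0 : ℝ)..s₁, ∫ l' in (l₁ - (s₁ - σ))..(l₁ + (s₁ - σ)),
      (l' / l₁) ^ q * K (coneRatio l₁ (s₁ - σ) l') * Ψ (l', σ) := by
    -- The open interval is used because positivity of U is known only strictly between times 0 and
    -- s₁.
    rw [intervalIntegral.integral_of_le hs₁.le, integral_Ioc_eq_integral_Ioo]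
    refine setIntegral_nonneg measurableSet_Ioo fun σ hσ => ?_
    refine intervalIntegral.integral_nonneg (by linarith [hσ.2]) fun l' hl' => ?_
    have hmem := backwardCone_subset h1 (mem_backwardCone_iff.2 ⟨Ioo_subset_Icc_self hσ, hl'⟩)
    have h4 := hkb l₁ s₁ h1 l' (s₁ - σ) (by linarith [hσ.2]) (by linarith [hσ.1])
      (abs_le.2 ⟨by linarith [hl'.1], by linarith [hl'.2]⟩)
    exact mul_nonneg (hb0.le.trans h4.1) (hsign _ hmem (hbefore _ hmem hσ.1 hσ.2).le)
  have h5 := heq l₁ s₁ h1 hs₁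
  have h6 := hfree l₁ s₁ h1 hs₁
  have h7 : 0 < 2 * (ε * b * c) * s₁ := by positivity
  have h8 : U (l₁, s₁) ≤ 0 := h3
  linarith

/-- The lower bound at the vertex of the backward cone. -/
theorem lower_bound_of_cone_equation (hK : ContinuousOn K (Iio 1)) (hδ2 : 2 ≤ δ)
    (hker : ∀ r t l : ℝ, 0 < r → 0 ≤ t → δ * t ≤ r - t → |l - r| ≤ t →
      1 / 8 * (l / r) ^ m ≤ (l / r) ^ q * K (coneRatio r t l) ∧
      (l / r) ^ q * K (coneRatio r t l) ≤ C)
    (hr : 0 < r) (ht : 0 ≤ t) (hrt : δ * t ≤ r - t) (hε : 0 < ε)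
    (hg : ContinuousOn g₀ (Icc (r - t) (r + t))) (hgpos : ∀ l ∈ Icc (r - t) (r + t), 0 < g₀ l)
    (hΨ : ContinuousOn Ψ (backwardCone r t))
    (hΨ0 : ∀ p ∈ backwardCone r t, 0 < p.2 → 0 ≤ Ψ p) :
    ε / (8 * r ^ m) * (∫ l in (r - t)..(r + t), l ^ m * g₀ l) +
      1 / (8 * r ^ m) * (∫ s in (0 : ℝ)..t, ∫ l in (r - (t - s))..(r + (t - s)),
        l ^ m * Ψ (l, s)) ≤
      ε * (∫ l in (r - t)..(r + t), (l / r) ^ q * K (coneRatio r t l) * g₀ l) +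
      ∫ s in (0 : ℝ)..t, ∫ l in (r - (t - s))..(r + (t - s)),
        (l / r) ^ q * K (coneRatio r (t - s) l) * Ψ (l, s) := by
  have ht2 : t ≤ r / 2 := by nlinarith
  have hpow : ∀ l : ℝ, 1 / 8 * (l / r) ^ m = 1 / (8 * r ^ m) * l ^ m := by
    intro l
    rw [div_pow]
    field_simp
  refine add_le_add ?_ ?_
  · rw [show ε / (8 * r ^ m) = ε * (1 / (8 * r ^ m)) by ring, mul_assoc]
    refine mul_le_mul_of_nonneg_left ?_ hε.le
    rw [← intervalIntegral.integral_const_mul]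
    have hle : r - t ≤ r + t := by linarith
    refine intervalIntegral.integral_mono_on hle ?_ ?_ fun l hl => ?_
    · refine ContinuousOn.intervalIntegrable ?_
      rw [uIcc_of_le hle]
      exact continuousOn_const.mul ((continuousOn_id.pow m).mul hg)
    · refine ContinuousOn.intervalIntegrable ?_
      rw [uIcc_of_le hle]
      exact (continuousOn_coneKernel hK q hr ⟨ht, ht2⟩).mul hg
    · rw [← mul_assoc, ← hpow]
      exact mul_le_mul_of_nonneg_right (hker r t l hr ht hrt
        (abs_le.2 ⟨by linarith [hl.1], by linarith [hl.2]⟩)).1 (hgpos l hl).le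
  · have hH1 : ContinuousOn (fun p : ℝ × ℝ => p.1 ^ m * Ψ p) (backwardCone r t) :=
      ContinuousOn.mul (by fun_prop) hΨ
    have hH2 := (continuousOn_coneKernel_prod hK q hr ht2).mul hΨ
    have hc1 := continuousOn_integral_slice hH1
    have hc2 := continuousOn_integral_slice hH2
    rw [← intervalIntegral.integral_const_mul]
    refine intervalIntegral.integral_mono_on_of_le_Ioo ht ?_ ?_ fun s hs => ?_
    · refine ContinuousOn.intervalIntegrable ?_
      rw [uIcc_of_le ht]
      exact continuousOn_const.mul hc1
    · refine ContinuousOn.intervalIntegrable ?_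
      rw [uIcc_of_le ht]
      exact hc2
    · have hs' := Ioo_subset_Icc_self hs
      rw [← intervalIntegral.integral_const_mul]
      refine intervalIntegral.integral_mono_on (by linarith [hs.2])
        ((intervalIntegrable_slice hH1 hs').const_mul _) (intervalIntegrable_slice hH2 hs')
        fun l hl => ?_
      rw [← mul_assoc, ← hpow]
      exact mul_le_mul_of_nonneg_right (hker r (t - s) l hr (by linarith [hs.2])
        (by nlinarith [hs.1]) (abs_le.2 ⟨by linarith [hl.1], by linarith [hl.2]⟩)).1
        (hΨ0 _ (mem_backwardCone_iff.2 ⟨hs', hl⟩) hs.1)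

end Cone

end HartreeWave

/-! ### Vanishing data and the final assembly -/

namespace HartreeWave

theorem waveOp_zero (n : ℕ) (x : EuclideanSpace ℝ (Fin n)) (t : ℝ) :
    waveOp n (fun _ => 0) x t = 0 := by
  -- Zero is written as 0 · 0 so that a constant factor 0 can be pulled out of the iterated
  -- operator.
  have h : (fun τ : ℝ => τ ^ (2 * (n / 2) - 1) * waveMean n (fun _ => 0) x τ) =
      fun τ => (0 : ℝ) * 0 := by
    funext τ
    simp [waveMean]
  rw [waveOp, h, invTimeDeriv_iterate_const_mul]
  simp

theorem freePart_of_zero {n : ℕ} {f g : EuclideanSpace ℝ (Fin n) → ℝ} (hf : ∀ x, f x = 0)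
    (x : EuclideanSpace ℝ (Fin n)) (t : ℝ) : freePart n f g x t = waveOp n g x t := by
  obtain rfl : f = fun _ => 0 := funext hf
  simp [freePart, waveOp_zero]

theorem potentialConv_nonneg {n : ℕ} {γ : ℝ} {U : EuclideanSpace ℝ (Fin n) → ℝ}
    (hU : ∀ y, 0 ≤ U y) (x : EuclideanSpace ℝ (Fin n)) : 0 ≤ potentialConv n γ U x :=
  integral_nonneg fun y => mul_nonneg (Real.rpow_nonneg (norm_nonneg _) _) (hU y)

end HartreeWave

end

theorem proposition3p1 (n : ℕ) (hn : 2 ≤ n) :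
    ∃ δ : ℝ, 0 < δ ∧
      ∀ (γ ν R A ε T : ℝ) (f g : EuclideanSpace ℝ (Fin n) → ℝ) (g₀ : ℝ → ℝ) (u : ℝ → ℝ → ℝ),
        HartreeWave.DataAssumptions n γ ν R A f g g₀ → 0 < ε → 0 < T →
        HartreeWave.IsRadialSolution n γ ε f g T u →
        ∀ r t : ℝ, (r, t) ∈ HartreeWave.exteriorRegion T R δ →
          0 < u r t ∧
          (∀ s ∈ Set.Icc 0 t, IntervalIntegrable
            (fun l => l ^ (n / 2) * HartreeWave.radialConv n γ (fun ρ => u ρ s ^ 2) l * u l s)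
            MeasureTheory.volume (r - t + s) (r + t - s)) ∧
          IntervalIntegrable
            (fun s => 1 / (1 + s) ^ 2 * ∫ l in (r - t + s)..(r + t - s),
              l ^ (n / 2) * HartreeWave.radialConv n γ (fun ρ => u ρ s ^ 2) l * u l s)
            MeasureTheory.volume 0 t ∧
          ε / (8 * r ^ (n / 2)) * (∫ l in (r - t)..(r + t), l ^ (n / 2) * g₀ l) +
            1 / (8 * r ^ (n / 2)) *
              (∫ s in (0 : ℝ)..t, 1 / (1 + s) ^ 2 * ∫ l in (r - t + s)..(r + t - s),
                l ^ (n / 2) * HartreeWave.radialConv n γ (fun ρ => u ρ s ^ 2) l * u l s)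
            ≤ u r t := by
  open HartreeWave in
  obtain ⟨q, K, hq1, hq2, hK, hK0, hrep⟩ := exists_waveOp_rep hn
  obtain ⟨δ, C, hδ2, hC, hker⟩ := exists_coneKernel_bounds hK hK0 (m := n / 2) (by omega) hq1 hq2
  refine ⟨δ, by linarith, ?_⟩
  rintro γ ν R A ε T f g g₀ u hdata hε hT hsol r t ⟨hr, ⟨ht, htT⟩, hmax⟩
  simp only at hr ht htT hmax
  have hrR : R ≤ r - t := (le_max_left _ _).trans hmax
  have hrt : δ * t ≤ r - t := (le_max_right _ _).trans hmax
  have hR := hdata.R_pos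
  set e : EuclideanSpace ℝ (Fin n) := EuclideanSpace.single ⟨0, by omega⟩ 1 with he
  have hnorm : ∀ l : ℝ, 0 ≤ l → ‖l • e‖ = l := fun l hl => by simp [he, norm_smul, abs_of_nonneg hl]
  have hne : ∀ l : ℝ, 0 < l → l • e ≠ 0 := fun l hl => by
    rw [← norm_pos_iff, hnorm l hl.le]; exact hl
  set Φ : ℝ × ℝ → ℝ := fun p => radialConv n γ (fun ρ => u ρ p.2 ^ 2) p.1 * u p.1 p.2 with hΦ
  have hcubic : ∀ s ∈ Ico 0 T, ∀ y : EuclideanSpace ℝ (Fin n), y ≠ 0 →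
      cubicTerm n γ u y s = Φ (‖y‖, s) := fun s hs y hy => by
    rw [cubicTerm, potentialConv_eq_radialConv hn γ (fun ρ => u ρ s ^ 2) hy
      (hsol.integrable_conv y hy s hs)]
  -- Continuity of G_γ(u²)u is inherited from the assumed continuity of the cubic term along the ray
  -- through `e`.
  have hΦc : ContinuousOn Φ (Ioi 0 ×ˢ Ico 0 T) := by
    refine (hsol.continuousOn_cubicTerm.comp (f := fun p : ℝ × ℝ => (p.1 • e, p.2)) (by fun_prop)
      fun p hp => ⟨hne _ hp.1, hp.2⟩).congr fun p hp => ?_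
    simp only [Function.comp]
    rw [hcubic _ hp.2 _ (hne _ hp.1), hnorm _ (le_of_lt hp.1)]
  -- G_γ(u²) is nonnegative because it equals the convolution of nonnegative functions; its kernel
  -- need not be examined.
  have hΦ0 : ∀ p ∈ Ioi (0 : ℝ) ×ˢ Ico 0 T, 0 ≤ u p.1 p.2 → 0 ≤ Φ p := by
    rintro ⟨l, s⟩ ⟨hl, hs⟩ hu
    refine mul_nonneg ?_ hu
    have h := potentialConv_eq_radialConv hn γ (fun ρ => u ρ s ^ 2) (hne l hl)
      (hsol.integrable_conv _ (hne l hl) s hs)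
    rw [hnorm l (le_of_lt hl)] at h
    change 0 ≤ radialConv n γ (fun ρ => u ρ s ^ 2) l
    rw [← h]
    exact potentialConv_nonneg (fun y => sq_nonneg _) _
  have hsub : backwardCone r t ⊆ Ioi 0 ×ˢ Ico 0 T := by
    rintro ⟨l, s⟩ h
    obtain ⟨h1, h2, -, -, -⟩ := mem_backwardCone_flat hδ2 ht.le hr hrt h
    exact ⟨h1, h2, (mem_backwardCone_iff.1 h).1.2.trans_lt htT⟩
  set Ψ : ℝ × ℝ → ℝ := fun p => Φ p / (1 + p.2) ^ 2 with hΨ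
  have hΨc : ContinuousOn Ψ (Ioi 0 ×ˢ Ico 0 T) :=
    hΦc.div (by fun_prop) fun p hp => by
      have : 0 ≤ p.2 := hp.2.1
      positivity
  have hgc : ContinuousOn g₀ (Ioi 0) := by
    refine (hdata.continuous_g.comp (by fun_prop : Continuous fun l : ℝ => l • e)).continuousOn.congr
      fun l hl => ?_
    simp only [Function.comp]
    rw [hdata.radial_g, hnorm l (le_of_lt hl)]
  have hgsub : Icc (r - t) (r + t) ⊆ Ioi 0 := fun l hl => lt_of_lt_of_le (by linarith) hl.1
  have hgpos : ∀ l ∈ Icc (r - t) (r + t), 0 < g₀ l := by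
    intro l hl
    have hl0 : 0 < l := hgsub hl
    have h := hdata.lower_g (l • e) (by rw [hnorm l hl0.le]; linarith [hl.1])
    rw [hdata.radial_g, hnorm l hl0.le] at h
    have := hdata.A_pos
    exact lt_of_lt_of_le (by positivity) h
  have heq : ∀ l s, (l, s) ∈ backwardCone r t → 0 < s → u l s =
      ε * (∫ l' in (l - s)..(l + s), (l' / l) ^ q * K (coneRatio l s l') * g₀ l') +
      ∫ σ in (0 : ℝ)..s, ∫ l' in (l - (s - σ))..(l + (s - σ)),
        (l' / l) ^ q * K (coneRatio l (s - σ) l') * Ψ (l', σ) := by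
    intro l s h hs
    obtain ⟨hl, -, -, hs3, -⟩ := mem_backwardCone_flat hδ2 ht.le hr hrt h
    have hsT := (hsub h).2
    have h1 := hsol.equation (l • e) (hne l hl) s hsT
    rw [freePart_of_zero hdata.f_zero, hrep _ g g₀ hgc (fun y _ => hdata.radial_g y) s
      (by rw [hnorm l hl.le]; exact ⟨hs, by linarith⟩), hnorm l hl.le] at h1
    rw [h1]
    congr 1
    -- The endpoint σ = s is discarded because the representation of W requires s - σ > 0.
    rw [duhamel, intervalIntegral.integral_of_le hs.le, intervalIntegral.integral_of_le hs.le,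
      integral_Ioc_eq_integral_Ioo, integral_Ioc_eq_integral_Ioo]
    refine setIntegral_congr_fun measurableSet_Ioo fun σ hσ => ?_
    have hσT : σ ∈ Ico 0 T := ⟨hσ.1.le, hσ.2.trans hsT.2⟩
    have h2 := hrep (l • e) (fun y => cubicTerm n γ u y σ / (1 + σ) ^ 2) (fun l' => Ψ (l', σ))
      (hΨc.comp (by fun_prop) fun l' hl' => ⟨hl', hσT⟩)
      (fun y hy => by simp only [hΨ]; rw [hcubic σ hσT y hy]) (s - σ)
      (by rw [hnorm l hl.le]; exact ⟨by linarith [hσ.2], by linarith [hσ.1]⟩)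
    rw [hnorm l hl.le] at h2
    exact h2
  have hpos := pos_of_cone_equation hK hδ2 hC hker hr ht.le hrt hε (hgc.mono hgsub) hgpos
    (U := fun p => u p.1 p.2) (hsol.continuousOn.mono hsub) (hΨc.mono hsub)
    (fun p hp hu => div_nonneg (hΦ0 p (hsub hp) hu) (sq_nonneg _)) heq
  have hvertex : (r, t) ∈ backwardCone r t := mem_backwardCone_iff.2 ⟨⟨ht.le, le_rfl⟩, by simp⟩
  have hlow := lower_bound_of_cone_equation hK hδ2 hker hr ht.le hrt hε (hgc.mono hgsub) hgpos
    (hΨc.mono hsub)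
    (fun p hp hp0 => div_nonneg (hΦ0 p (hsub hp) (hpos p hp hp0).le) (sq_nonneg _))
  rw [← heq r t hvertex ht] at hlow
  have hleft : ∀ s, r - t + s = r - (t - s) := fun s => by ring
  have hright : ∀ s, r + t - s = r + (t - s) := fun s => by ring
  have hH : ContinuousOn (fun p : ℝ × ℝ => p.1 ^ (n / 2) *
      radialConv n γ (fun ρ => u ρ p.2 ^ 2) p.1 * u p.1 p.2) (backwardCone r t) := by
    simp only [mul_assoc]
    exact ContinuousOn.mul (by fun_prop) (hΦc.mono hsub)
  have hweight : ∀ s : ℝ, ∫ l in (r - (t - s))..(r + (t - s)), l ^ (n / 2) * Ψ (l, s) =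
      1 / (1 + s) ^ 2 * ∫ l in (r - (t - s))..(r + (t - s)), l ^ (n / 2) *
        radialConv n γ (fun ρ => u ρ s ^ 2) l * u l s := by
    intro s
    rw [← intervalIntegral.integral_const_mul]
    refine intervalIntegral.integral_congr fun l _ => ?_
    simp only [hΨ, hΦ]
    ring
  simp only [hleft, hright]
  refine ⟨hpos _ hvertex ht, fun s hs => intervalIntegrable_slice hH hs, ?_, ?_⟩
  · refine ContinuousOn.intervalIntegrable ?_
    rw [uIcc_of_le ht.le]
    refine ContinuousOn.mul (ContinuousOn.div (by fun_prop) (by fun_prop) fun s hs => ?_)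
      (continuousOn_integral_slice hH)
    have : 0 ≤ s := hs.1
    positivity
  · simp only [hweight] at hlow
    exact hlow
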